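/- Let $T>0$ and let $\mathbb{V}\subset\mathbb{H}\subset\mathbb{V}^*$ be a Hilbert triplet, i.e. $\mathbb{V}$ and $\mathbb{H}$ are real Hilbert spaces, $\mathbb{V}$ is continuously and densely embedded in $\mathbb{H}$, and $h\in\mathbb{H}$ is identified with the functional $v\mapsto (h,v)_{\mathbb{H}}$ in the dual $\mathbb{V}^*$ of $\mathbb{V}$. Assume that $\mathbb{V}$ is separable. Let $\mathbb{A}\in\mathcal{L}(\mathbb{H},\mathbb{H})$, $\mathbb{B}\in\mathcal{L}(\mathbb{V},\mathbb{V}^*)$ and $\mathbb{C}(t)\in\mathcal{L}(\mathbb{V},\mathbb{H})$ satisfy, for some positive constants $\alpha$, $\lambda$ and $K$, $$(\mathbb{A}w,w)_{\mathbb{H}}\ge\alpha\|w\|_{\mathbb{H}}^2\quad\text{for every } w\in\mathbb{H},$$ $$\langle\mathbb{B}w,w\rangle_{\mathbb{V}}+\lambda\|w\|_{\mathbb{H}}^2\ge\alpha\|w\|_{\mathbb{V}}^2\quad\text{for every } w\in\mathbb{V},$$ $$\|\mathbb{C}(t)w\|_{\mathbb{H}}\le K\|w\|_{\mathbb{V}}\quad\text{for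 a.a. } t\in(0,T)\text{ and every } w\in\mathbb{V},$$ and, for every $w_1\in\mathbb{V}$ and $w_2\in\mathbb{H}$, let the function $t\mapsto(\mathbb{C}(t)w_1,w_2)_{\mathbb{H}}$ be (Lebesgue) measurable on $(0,T)$. Moreover, assume that $\mathbb{B}$ is symmetric, i.e. $\langle\mathbb{B}v,w\rangle_{\mathbb{V}}=\langle\mathbb{B}w,v\rangle_{\mathbb{V}}$ for all $v,w\in\mathbb{V}$. Then, for every $F\in L^2(0,T;\mathbb{H})$ and $w_T\in\mathbb{V}$, there exists a unique $$w\in H^1(0,T;\mathbb{H})\cap L^\infty(0,T;\mathbb{V})$$ satisfying $$-\mathbb{A}w'(t)+\mathbb{B}w(t)+\mathbb{C}(t)w(t)=F(t)\quad\text{in }\mathbb{V}^*\text{ for a.a. } t\in(0,T),\qquad w(T)=w_T,$$ where $w'$ is the weak derivative of $w$ and $w(T)$ is the value at $T$ of the representative of $w$ in $C^0([0,T];\mathbb{H})$. -/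

import Mathlib

open MeasureTheory Set
open scoped ContDiff InnerProductSpace

noncomputable section

/-- Lebesgue measure on the open time interval `(0,T)`. -/
abbrev timeMeasure (T : ℝ) : Measure ℝ := volume.restrict (Ioo 0 T)

/-- `u` belongs to `H¹(0,T;E)` and its weak derivative is `u'`: both functions are in `L²(0,T;E)`
and `∫ φ' u = - ∫ φ u'` for every test function `φ ∈ C_c^∞(0,T)`. -/
structure HasH1Deriv {E : Type*} [NormedAddCommGroup E] [NormedSpace ℝ E]
    (T : ℝ) (u u' : ℝ → E) : Prop where
  memLp : MemLp u 2 (timeMeasure T)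
  memLp_deriv : MemLp u' 2 (timeMeasure T)
  integral_eq : ∀ φ : ℝ → ℝ, ContDiff ℝ ∞ φ → HasCompactSupport φ → tsupport φ ⊆ Ioo 0 T →
    ∫ t in Ioo 0 T, deriv φ t • u t = - ∫ t in Ioo 0 T, φ t • u' t

/-- The final value at time `T` of `u ∈ H¹(0,T;E) ⊂ C⁰([0,T];E)` is `e`: the representative of `u`
that is continuous on `[0,T]` takes the value `e` at `T`. -/
def HasFinalValue {E : Type*} [NormedAddCommGroup E] (T : ℝ) (u : ℝ → E) (e : E) : Prop :=
  ∃ v : ℝ → E, ContinuousOn v (Icc 0 T) ∧ v =ᵐ[timeMeasure T] u ∧ v T = e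

section Triplet

variable {V H : Type*} [NormedAddCommGroup V] [InnerProductSpace ℝ V]
  [NormedAddCommGroup H] [InnerProductSpace ℝ H]

/-- `j : V → H` makes `V ⊂ H ⊂ V*` a Hilbert triplet: it is a continuous and dense embedding
(completeness of `V` and `H` is required separately). -/
structure IsHilbertTriplet (j : V →L[ℝ] H) : Prop where
  injective : Function.Injective j
  denseRange : DenseRange j

/-- The embedding `H ⊂ V*` of the triplet: `h` acts on `V` as `v ↦ (h, v)_H`. -/
def toDualV (j : V →L[ℝ] H) (h : H) : StrongDual ℝ V := (innerSL ℝ h).comp j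

/-- `w ∈ H¹(0,T;H) ∩ L^∞(0,T;V)` satisfies `-A w' + B w + C(t) w = F` in `V*` for almost every
`t ∈ (0,T)`, together with the final condition `w(T) = wT`. -/
def IsFinalValueSolution (j : V →L[ℝ] H) (T : ℝ) (A : H →L[ℝ] H) (B : V →L[ℝ] StrongDual ℝ V)
    (C : ℝ → V →L[ℝ] H) (F : Lp H 2 (timeMeasure T)) (wT : V)
    (w : Lp V ⊤ (timeMeasure T)) : Prop :=
  (∃ w' : ℝ → H, HasH1Deriv T (fun t => j (w t)) w' ∧
    ∀ᵐ t ∂(timeMeasure T),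
      - toDualV j (A (w' t)) + B (w t) + toDualV j (C t (w t)) = toDualV j (F t)) ∧
  HasFinalValue T (fun t => j (w t)) (j wT)

end Triplet

end

/-! ### Integration by parts for primitives of integrable functions -/

section Primitive

variable {E F G : Type*} [NormedAddCommGroup E] [NormedSpace ℝ E]
  [NormedAddCommGroup F] [NormedSpace ℝ F] [NormedAddCommGroup G] [NormedSpace ℝ G]

/-! Adding `lam` times the inner product of `H` to `B` and subtracting `lam • j` from `C` leaves the
equation unchanged. So `B` may be taken coercive on `V`, and then ⟨Bw, w⟩ controls ‖w‖² in `V`.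

Existence. Put p = -w', so that w = wT + ∫_t^T p and A p + B w + C w = F. Test this with e^{kt}ψ, ψ
∈ L²(0,T;V). For φ = ∫_t^T ψ, symmetry of `B` gives ∫ e^{kt} B(φ,ψ) = ½ B(φ(0),φ(0)) + (k/2) ∫
e^{kt} B(φ,φ). For large k this absorbs the `C` term, and `A` controls ψ in `H`: the form is
coercive in (ψ, φ, φ(0)), see `weighted_form_coercive`. Lions' projection theorem,
`exists_mem_closure_range_forall_inner_eq`, then yields p ∈ L²(0,T;H) and w ∈ L²(0,T;V), see
`exists_weak_solution`.

Boundedness in V. Now Bw = f ∈ L²(0,T;H) and w' ∈ L²(0,T;H), and formally d/dt ⟨Bw, w⟩ = 2(f, w').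
Since w' need not lie in `V`, `B` is replaced by its Yosida approximations, bounded symmetric
operators on `H`. In the limit an energy inequality survives (`form_energy_le`), which is all that
is needed (`form_solution_bounded`).

Uniqueness. For a difference of solutions the same inequality, coercivity of `A` and Young's
inequality bound ‖w(t)‖² by a multiple of ∫_t^T ‖w‖², and Gronwall concludes
(`form_solution_eq_zero`). -/

theorem continuousOn_of_eq_primitive {f U : ℝ → E} {a b : ℝ}
    (hf : IntervalIntegrable f volume a b) (hab : a ≤ b)
    (hU : ∀ t ∈ Icc a b, U t = U a + ∫ s in a..t, f s) : ContinuousOn U (Icc a b) := by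
  have h := intervalIntegral.continuousOn_primitive_interval'
    (f := f) (μ := volume) (a := a) (b₁ := a) (b₂ := b) hf (by simp)
  rw [uIcc_of_le hab] at h
  exact (continuousOn_const.add h).congr hU

theorem IntervalIntegrable.clm_continuousOn (L : E →L[ℝ] F →L[ℝ] G) {g : ℝ → F} {U : ℝ → E}
    {a b : ℝ} (hab : a ≤ b) (hU : ContinuousOn U (Icc a b))
    (hg : IntervalIntegrable g volume a b) :
    IntervalIntegrable (fun t => L (U t) (g t)) volume a b := by
  rw [intervalIntegrable_iff_integrableOn_Ioc_of_le hab] at hg ⊢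
  obtain ⟨M, hM⟩ := isCompact_Icc.exists_bound_of_continuousOn hU
  have hUm : AEStronglyMeasurable U (volume.restrict (Ioc a b)) :=
    (hU.mono Ioc_subset_Icc_self).aestronglyMeasurable measurableSet_Ioc
  refine Integrable.mono' (g := fun t => ‖L‖ * M * ‖g t‖) (hg.norm.const_mul _)
    (L.aestronglyMeasurable_comp₂ hUm hg.1) ?_
  filter_upwards [ae_restrict_mem measurableSet_Ioc] with t ht
  refine (L.le_opNorm₂ _ _).trans ?_
  gcongr
  exact hM t (Ioc_subset_Icc_self ht)

/-- Fubini for L(f(s), g(t)) on the square: the two halves cut off by the diagonal are the two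
iterated integrals on the left. -/
theorem integral_bilin_primitive_zero [CompleteSpace E] [CompleteSpace F] [CompleteSpace G]
    (L : E →L[ℝ] F →L[ℝ] G) {f : ℝ → E} {g : ℝ → F} {a b : ℝ} (hab : a ≤ b)
    (hf : IntervalIntegrable f volume a b) (hg : IntervalIntegrable g volume a b) :
    (∫ t in a..b, L (∫ s in a..t, f s) (g t)) + (∫ t in a..b, L (f t) (∫ s in a..t, g s)) =
      L (∫ s in a..b, f s) (∫ s in a..b, g s) := by
  simp only [intervalIntegral.integral_of_le hab]
  rw [intervalIntegrable_iff_integrableOn_Ioc_of_le hab] at hf hg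
  set μ := volume.restrict (Ioc a b) with hμ
  have hint : Integrable (fun z : ℝ × ℝ => L (f z.1) (g z.2)) (μ.prod μ) := by
    refine Integrable.mono' (g := fun z => ‖L‖ * (‖f z.1‖ * ‖g z.2‖))
      ((hf.norm.mul_prod hg.norm).const_mul _) ?_ ?_
    · exact L.aestronglyMeasurable_comp₂ hf.1.comp_fst hg.1.comp_snd
    · exact Filter.Eventually.of_forall fun z => by
        rw [← mul_assoc]; exact L.le_opNorm₂ _ _
  have hs : MeasurableSet {z : ℝ × ℝ | z.1 ≤ z.2} := measurableSet_le measurable_fst measurable_snd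
  have hsplit := integral_add_compl hs hint
  rw [show ∫ z, L (f z.1) (g z.2) ∂(μ.prod μ) = L (∫ s, f s ∂μ) (∫ s, g s ∂μ) from
    integral_prod_bilin L hf hg] at hsplit
  rw [← hsplit]
  congr 1
  · rw [← integral_indicator hs, integral_prod_symm _ (hint.indicator hs)]
    refine integral_congr_ae ?_
    filter_upwards [ae_restrict_mem measurableSet_Ioc] with t ht
    have : ∀ s, ({z : ℝ × ℝ | z.1 ≤ z.2}.indicator (fun z => L (f z.1) (g z.2)) (s, t)) =
        (Iic t).indicator (fun s => L.flip (g t) (f s)) s := by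
      intro s; simp [indicator]
    simp only [this]
    rw [integral_indicator measurableSet_Iic, hμ, Measure.restrict_restrict measurableSet_Iic,
      intervalIntegral.integral_of_le ht.1.le]
    have h2 : Iic t ∩ Ioc a b = Ioc a t := by
      ext s; simp only [mem_inter_iff, mem_Iic, mem_Ioc]
      constructor
      · rintro ⟨h1, h2, h3⟩; exact ⟨h2, h1⟩
      · rintro ⟨h1, h2⟩; exact ⟨h2, h1, h2.trans ht.2⟩
    rw [h2, ContinuousLinearMap.integral_comp_comm]
    · rfl
    · exact hf.mono_set (Ioc_subset_Ioc_right ht.2)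
  · rw [← integral_indicator hs.compl, integral_prod _ (hint.indicator hs.compl)]
    refine integral_congr_ae ?_
    filter_upwards [ae_restrict_mem measurableSet_Ioc] with t ht
    have : ∀ s, (({z : ℝ × ℝ | z.1 ≤ z.2}ᶜ).indicator (fun z => L (f z.1) (g z.2)) (t, s)) =
        (Iio t).indicator (fun s => L (f t) (g s)) s := by
      intro s; simp [indicator]
    simp only [this]
    rw [integral_indicator measurableSet_Iio, hμ, Measure.restrict_restrict measurableSet_Iio,
      intervalIntegral.integral_of_le ht.1.le]
    have h2 : Iio t ∩ Ioc a b = Ioo a t := by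
      ext s; simp only [mem_inter_iff, mem_Iio, mem_Ioc, mem_Ioo]
      constructor
      · rintro ⟨h1, h2, h3⟩; exact ⟨h2, h1⟩
      · rintro ⟨h1, h2⟩; exact ⟨h2, h1, h2.le.trans ht.2⟩
    rw [h2, ← integral_Ioc_eq_integral_Ioo, ContinuousLinearMap.integral_comp_comm]
    exact hg.mono_set (Ioc_subset_Ioc_right ht.2)

/-- Integration by parts for primitives of integrable functions. -/
theorem integral_bilin_primitive [CompleteSpace E] [CompleteSpace F] [CompleteSpace G]
    (L : E →L[ℝ] F →L[ℝ] G) {f U : ℝ → E} {g W : ℝ → F} {a b : ℝ} (hab : a ≤ b)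
    (hf : IntervalIntegrable f volume a b) (hg : IntervalIntegrable g volume a b)
    (hU : ∀ t ∈ Icc a b, U t = U a + ∫ s in a..t, f s)
    (hW : ∀ t ∈ Icc a b, W t = W a + ∫ s in a..t, g s) :
    (∫ t in a..b, L (U t) (g t)) + (∫ t in a..b, L (f t) (W t)) =
      L (U b) (W b) - L (U a) (W a) := by
  have h0 := integral_bilin_primitive_zero L hab hf hg
  have hPf : ContinuousOn (fun t => ∫ s in a..t, f s) (Icc a b) :=
    continuousOn_of_eq_primitive hf hab (by simp)
  have hPg : ContinuousOn (fun t => ∫ s in a..t, g s) (Icc a b) :=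
    continuousOn_of_eq_primitive hg hab (by simp)
  have h1 : (∫ t in a..b, L (U t) (g t)) =
      L (U a) (∫ s in a..b, g s) + ∫ t in a..b, L (∫ s in a..t, f s) (g t) := by
    rw [← ContinuousLinearMap.intervalIntegral_comp_comm _ hg,
      ← intervalIntegral.integral_add]
    · refine intervalIntegral.integral_congr fun t ht => ?_
      rw [uIcc_of_le hab] at ht
      simp only [hU t ht, map_add, add_apply]
    · exact IntervalIntegrable.clm_continuousOn L hab continuousOn_const hg
    · exact IntervalIntegrable.clm_continuousOn L hab hPf hg
  have h2 : (∫ t in a..b, L (f t) (W t)) =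
      L (∫ s in a..b, f s) (W a) + ∫ t in a..b, L (f t) (∫ s in a..t, g s) := by
    have : L (∫ s in a..b, f s) (W a) = ∫ t in a..b, L.flip (W a) (f t) := by
      rw [ContinuousLinearMap.intervalIntegral_comp_comm _ hf]; rfl
    rw [this, ← intervalIntegral.integral_add]
    · refine intervalIntegral.integral_congr fun t ht => ?_
      rw [uIcc_of_le hab] at ht
      simp only [hW t ht, map_add, ContinuousLinearMap.flip_apply]
    · exact IntervalIntegrable.clm_continuousOn L.flip hab continuousOn_const hf
    · exact IntervalIntegrable.clm_continuousOn L.flip hab hPg hf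
  have hb : b ∈ Icc a b := right_mem_Icc.2 hab
  rw [h1, h2, hU b hb, hW b hb]
  simp only [map_add, add_apply]
  rw [← h0]
  abel

end Primitive

/-! ### Weak derivatives and continuous representatives -/

section WeakDerivative

variable {E : Type*} [NormedAddCommGroup E]

theorem MeasureTheory.MemLp.intervalIntegrable_of_timeMeasure {T : ℝ} (hT : 0 ≤ T) {g : ℝ → E}
    (hg : MemLp g 2 (timeMeasure T)) : IntervalIntegrable g volume 0 T := by
  rw [intervalIntegrable_iff_integrableOn_Ioo_of_le hT]
  exact hg.integrable one_le_two

theorem IntervalIntegrable.mono_of_mem_Icc {T a b : ℝ} {g : ℝ → E}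
    (hg : IntervalIntegrable g volume 0 T) (ha : a ∈ Icc 0 T) (hb : b ∈ Icc 0 T) :
    IntervalIntegrable g volume a b :=
  hg.mono_set <| by
    rw [uIcc_of_le (ha.1.trans ha.2)]
    exact uIcc_subset_Icc ha hb

/-- Integration by parts with φ seen as the primitive of its own derivative; the boundary terms
vanish because φ(0) = φ(T) = 0. -/
theorem integral_test_deriv_smul_primitive [NormedSpace ℝ E] [CompleteSpace E] {T : ℝ}
    (hT : 0 ≤ T) {g U : ℝ → E}
    (hg : IntervalIntegrable g volume 0 T)
    (hU : ∀ t ∈ Icc 0 T, U t = U 0 + ∫ s in 0..t, g s) {φ : ℝ → ℝ} (hφ : ContDiff ℝ ∞ φ)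
    (hφs : tsupport φ ⊆ Ioo 0 T) :
    ∫ t in Ioo 0 T, deriv φ t • U t = - ∫ t in Ioo 0 T, φ t • g t := by
  have hz : ∀ t, t ∉ Ioo 0 T → φ t = 0 := fun t ht =>
    image_eq_zero_of_notMem_tsupport fun h => ht (hφs h)
  have hdc : Continuous (deriv φ) := hφ.continuous_deriv (by simp)
  have hd : ∀ t ∈ Icc 0 T, φ t = φ 0 + ∫ s in 0..t, deriv φ s := fun t _ => by
    rw [intervalIntegral.integral_deriv_eq_sub]
    · ring
    · exact fun x _ => (hφ.differentiable (by simp)).differentiableAt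
    · exact hdc.intervalIntegrable _ _
  have key := integral_bilin_primitive (ContinuousLinearMap.lsmul ℝ ℝ : ℝ →L[ℝ] E →L[ℝ] E) hT
    (hdc.intervalIntegrable 0 T) hg hd hU
  simp only [ContinuousLinearMap.lsmul_apply, hz T (by simp), hz 0 (by simp), zero_smul,
    sub_zero] at key
  simp only [intervalIntegral.integral_of_le hT, integral_Ioc_eq_integral_Ioo] at key
  exact eq_neg_of_add_eq_zero_right key

theorem ContinuousOn.memLp_timeMeasure {T : ℝ} {U : ℝ → E} (hU : ContinuousOn U (Icc 0 T))
    (p : ENNReal) : MemLp U p (timeMeasure T) := by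
  obtain ⟨M, hM⟩ := isCompact_Icc.exists_bound_of_continuousOn hU
  refine MemLp.of_bound ((hU.mono Ioo_subset_Icc_self).aestronglyMeasurable measurableSet_Ioo) M ?_
  filter_upwards [ae_restrict_mem measurableSet_Ioo] with t ht
  exact hM t (Ioo_subset_Icc_self ht)

theorem hasH1Deriv_of_ae_eq_primitive [NormedSpace ℝ E] [CompleteSpace E] {T : ℝ}
    (hT : 0 ≤ T) {u g U : ℝ → E}
    (hg : MemLp g 2 (timeMeasure T))
    (hU : ∀ t ∈ Icc 0 T, U t = U 0 + ∫ s in 0..t, g s) (hu : u =ᵐ[timeMeasure T] U) :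
    HasH1Deriv T u g := by
  have hgi := hg.intervalIntegrable_of_timeMeasure hT
  refine ⟨(memLp_congr_ae hu).2 ?_, hg, fun φ hφ _ hφs => ?_⟩
  · exact (continuousOn_of_eq_primitive hgi hT hU).memLp_timeMeasure 2
  · rw [← integral_test_deriv_smul_primitive hT hgi hU hφ hφs]
    refine integral_congr_ae ?_
    filter_upwards [hu] with t ht
    rw [ht]

theorem MeasureTheory.Integrable.continuous_smul [NormedSpace ℝ E] {μ : Measure ℝ} {r : ℝ → E}
    (hr : Integrable r μ) {φ : ℝ → ℝ} (hφ : Continuous φ) (hφc : HasCompactSupport φ) :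
    Integrable (fun t => φ t • r t) μ := by
  obtain ⟨M, hM⟩ := hφ.bounded_above_of_compact_support hφc
  exact hr.bdd_smul M hφ.aestronglyMeasurable (.of_forall hM)

/-- The primitive from 0 vanishes to the left of the support of ψ, and the zero mean makes it vanish
to the right as well. -/
theorem exists_test_antideriv {T : ℝ} {ψ : ℝ → ℝ} (hψ : ContDiff ℝ ∞ ψ)
    (hc : HasCompactSupport ψ) (hs : tsupport ψ ⊆ Ioo 0 T) (h0 : ∫ t in Ioo 0 T, ψ t = 0) :
    ∃ φ : ℝ → ℝ, ContDiff ℝ ∞ φ ∧ HasCompactSupport φ ∧ tsupport φ ⊆ Ioo 0 T ∧ deriv φ = ψ := by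
  rcases (tsupport ψ).eq_empty_or_nonempty with he | hne
  · have : ψ = 0 := tsupport_eq_empty_iff.1 he
    exact ⟨0, contDiff_const, HasCompactSupport.zero, by simp [tsupport], by simp [this]⟩
  have hcomp : IsCompact (tsupport ψ) := hc
  set a := sInf (tsupport ψ)
  set b := sSup (tsupport ψ)
  have ha : a ∈ Ioo 0 T := hs (hcomp.sInf_mem hne)
  have hb : b ∈ Ioo 0 T := hs (hcomp.sSup_mem hne)
  have hsub : tsupport ψ ⊆ Icc a b := fun x hx =>
    ⟨csInf_le hcomp.bddBelow hx, le_csSup hcomp.bddAbove hx⟩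
  have hz : ∀ t, t ∉ Icc a b → ψ t = 0 := fun t ht =>
    image_eq_zero_of_notMem_tsupport fun h => ht (hsub h)
  have hT : 0 ≤ T := ha.1.le.trans ha.2.le
  have hder : ∀ t, HasDerivAt (fun t => ∫ s in 0..t, ψ s) (ψ t) t := fun t =>
    intervalIntegral.integral_hasDerivAt_right (hψ.continuous.intervalIntegrable _ _)
      (hψ.continuous.stronglyMeasurableAtFilter _ _) hψ.continuous.continuousAt
  have hd : deriv (fun t => ∫ s in 0..t, ψ s) = ψ := funext fun t => (hder t).deriv
  have hi : ∀ u v, IntervalIntegrable ψ volume u v := fun u v =>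
    hψ.continuous.intervalIntegrable u v
  have hfull : ∫ s in 0..T, ψ s = 0 := by
    rw [intervalIntegral.integral_of_le hT, integral_Ioc_eq_integral_Ioo, h0]
  have hzero : ∀ t, t ∉ Icc a b → ∫ s in 0..t, ψ s = 0 := by
    intro t ht
    rcases lt_or_ge t a with h | h
    · refine intervalIntegral.integral_zero_ae (Filter.Eventually.of_forall fun s hs => ?_)
      refine hz s fun h' => ?_
      rcases hs.2.trans (max_le ha.1.le h.le) |>.lt_or_eq with h1 | h1
      · exact absurd h'.1 (not_le.2 h1)
      · have : a ≤ max 0 t := h1 ▸ hs.2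
        exact absurd this (not_le.2 (max_lt ha.1 h))
    · have hbt : b < t := not_le.1 fun h' => ht ⟨h, h'⟩
      rw [← intervalIntegral.integral_add_adjacent_intervals (hi 0 T) (hi T t), hfull, zero_add]
      refine intervalIntegral.integral_zero_ae (Filter.Eventually.of_forall fun s hs => ?_)
      exact hz s fun h' => absurd (hs.1.trans_le h'.2) (not_lt.2 (le_min hb.2.le hbt.le))
  have hts : tsupport (fun t => ∫ s in 0..t, ψ s) ⊆ Icc a b := by
    refine closure_minimal (fun t ht => ?_) isClosed_Icc
    by_contra h
    exact ht (hzero t h)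
  refine ⟨fun t => ∫ s in 0..t, ψ s, ?_, ?_, hts.trans ?_, hd⟩
  · rw [show (∞ : WithTop ℕ∞) = ∞ from rfl, contDiff_infty_iff_deriv, hd]
    exact ⟨fun t => (hder t).differentiableAt, hψ⟩
  · exact isCompact_Icc.of_isClosed_subset (isClosed_tsupport _) hts
  · exact fun t ht => ⟨ha.1.trans_le ht.1, ht.2.trans_lt hb.2⟩

/-- The lemma of du Bois-Reymond: a function with vanishing weak derivative is constant. -/
theorem ae_eq_const_of_integral_deriv_smul_eq_zero [NormedSpace ℝ E] [CompleteSpace E] {T : ℝ}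
    (hT : 0 < T) {r : ℝ → E} (hr : Integrable r (timeMeasure T))
    (h : ∀ φ : ℝ → ℝ, ContDiff ℝ ∞ φ → HasCompactSupport φ → tsupport φ ⊆ Ioo 0 T →
      ∫ t in Ioo 0 T, deriv φ t • r t = 0) :
    ∃ c : E, ∀ᵐ t ∂timeMeasure T, r t = c := by
  -- A fixed bump η of positive integral; the constant is the η-weighted mean of r.
  have hmem : T / 2 ∈ Ioo 0 T := ⟨by linarith, by linarith⟩
  obtain ⟨η, hηs, hηc, hη, hηr, hη1⟩ :=
    exists_contDiff_tsupport_subset (n := ⊤) (isOpen_Ioo.mem_nhds hmem)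
  have hηpos : 0 < ∫ t in Ioo 0 T, η t := by
    rw [setIntegral_eq_integral_of_forall_compl_eq_zero fun t ht =>
      image_eq_zero_of_notMem_tsupport fun h => ht (hηs h)]
    exact hη.continuous.integral_pos_of_hasCompactSupport_nonneg_nonzero hηc
      (fun t => (hηr ⟨t, rfl⟩).1) (x := T / 2) (by rw [hη1]; exact one_ne_zero)
  have hint : ∀ ψ : ℝ → ℝ, ContDiff ℝ ∞ ψ → HasCompactSupport ψ → Integrable ψ (timeMeasure T) :=
    fun ψ hψ hc => (hψ.continuous.integrable_of_hasCompactSupport hc).restrict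
  have hintr : ∀ ψ : ℝ → ℝ, ContDiff ℝ ∞ ψ → HasCompactSupport ψ →
      Integrable (fun t => ψ t • r t) (timeMeasure T) := fun ψ hψ hc =>
    hr.continuous_smul hψ.continuous hc
  set I := ∫ t in Ioo 0 T, η t with hI
  set c : E := I⁻¹ • ∫ t in Ioo 0 T, η t • r t with hc
  refine ⟨c, ?_⟩
  have key := isOpen_Ioo.ae_eq_zero_of_integral_contDiff_smul_eq_zero (μ := volume) (U := Ioo 0 T)
    (f := (Ioo 0 T).indicator fun t => r t - c) ?_ ?_
  · rw [ae_restrict_iff' measurableSet_Ioo]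
    filter_upwards [key] with t ht hmem
    have := ht hmem
    rw [indicator_of_mem hmem] at this
    exact sub_eq_zero.1 this
  · refine (Integrable.locallyIntegrable ?_).locallyIntegrableOn _
    rw [integrable_indicator_iff measurableSet_Ioo]
    exact hr.sub (integrable_const c)
  · intro ψ hψ hψc hψs
    set J := ∫ t in Ioo 0 T, ψ t with hJ
    -- Subtracting the right multiple of η from ψ gives mean zero, hence the derivative of a test
    -- function.
    obtain ⟨φ, hφ, hφc, hφs, hφd⟩ := exists_test_antideriv (T := T)
      (ψ := fun t => ψ t - J * I⁻¹ * η t) (hψ.sub (contDiff_const.mul hη))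
      (hψc.sub hηc.mul_left)
      ((tsupport_sub _ _).trans (union_subset hψs (tsupport_mul_subset_right.trans hηs)))
      (by
        rw [integral_sub (hint ψ hψ hψc) ((hint η hη hηc).const_mul _), integral_const_mul,
          mul_assoc, inv_mul_cancel₀ hηpos.ne', mul_one, sub_self])
    have h1 := h φ hφ hφc hφs
    rw [hφd] at h1
    have h2 : ∀ t, (ψ t - J * I⁻¹ * η t) • r t = ψ t • r t - (J * I⁻¹) • (η t • r t) := by
      intro t; rw [sub_smul, mul_smul (J * I⁻¹)]
    simp only [h2] at h1
    have hs : Integrable (fun t => (J * I⁻¹) • (η t • r t)) (timeMeasure T) :=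
      (hintr η hη hηc).smul _
    rw [integral_sub (hintr ψ hψ hψc) hs, integral_smul] at h1
    have h3 : ∀ t, ψ t • (Ioo 0 T).indicator (fun t => r t - c) t =
        (Ioo 0 T).indicator (fun t => ψ t • r t - ψ t • c) t := by
      intro t
      by_cases ht : t ∈ Ioo 0 T <;> simp [ht, smul_sub]
    simp only [h3]
    rw [integral_indicator measurableSet_Ioo,
      integral_sub (hintr ψ hψ hψc) ((hint ψ hψ hψc).smul_const c), integral_smul_const, hc,
      smul_smul]
    exact h1

/-- The difference of u and the primitive of g has zero weak derivative, so du Bois-Reymond applies.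
-/
theorem HasH1Deriv.exists_ae_eq_primitive [NormedSpace ℝ E] [CompleteSpace E] {T : ℝ}
    (hT : 0 < T) {u g : ℝ → E}
    (h : HasH1Deriv T u g) :
    ∃ c : E, ∀ᵐ t ∂timeMeasure T, u t = c + ∫ s in 0..t, g s := by
  have hgi := h.memLp_deriv.intervalIntegrable_of_timeMeasure hT.le
  have hP : MemLp (fun t => ∫ s in 0..t, g s) 2 (timeMeasure T) :=
    (continuousOn_of_eq_primitive hgi hT.le (by simp)).memLp_timeMeasure 2
  obtain ⟨c, hc⟩ := ae_eq_const_of_integral_deriv_smul_eq_zero hT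
    (r := fun t => u t - ∫ s in 0..t, g s)
    ((h.memLp.sub hP).integrable one_le_two) (fun φ hφ hφc hφs => by
      have hdc : Continuous (deriv φ) := hφ.continuous_deriv (by simp)
      simp only [smul_sub]
      rw [integral_sub ((h.memLp.integrable one_le_two).continuous_smul hdc hφc.deriv)
        ((hP.integrable one_le_two).continuous_smul hdc hφc.deriv),
        h.integral_eq φ hφ hφc hφs,
        integral_test_deriv_smul_primitive hT.le hgi (by simp) hφ hφs, sub_self])
  exact ⟨c, hc.mono fun t ht => by rw [← ht]; abel⟩

theorem HasH1Deriv.sub [NormedSpace ℝ E] {T : ℝ} {u₁ u₂ g₁ g₂ : ℝ → E} (h₁ : HasH1Deriv T u₁ g₁)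
    (h₂ : HasH1Deriv T u₂ g₂) :
    HasH1Deriv T (fun t => u₁ t - u₂ t) (fun t => g₁ t - g₂ t) := by
  refine ⟨h₁.memLp.sub h₂.memLp, h₁.memLp_deriv.sub h₂.memLp_deriv, fun φ hφ hφc hφs => ?_⟩
  have hdc : Continuous (deriv φ) := hφ.continuous_deriv (by simp)
  simp only [smul_sub]
  rw [integral_sub ((h₁.memLp.integrable one_le_two).continuous_smul hdc hφc.deriv)
      ((h₂.memLp.integrable one_le_two).continuous_smul hdc hφc.deriv),
    integral_sub ((h₁.memLp_deriv.integrable one_le_two).continuous_smul hφ.continuous hφc)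
      ((h₂.memLp_deriv.integrable one_le_two).continuous_smul hφ.continuous hφc),
    h₁.integral_eq φ hφ hφc hφs, h₂.integral_eq φ hφ hφc hφs]
  abel

theorem HasFinalValue.eq_of_ae_eq {T : ℝ} (hT : 0 < T) {u U : ℝ → E} {e : E}
    (h : HasFinalValue T u e) (hU : ContinuousOn U (Icc 0 T)) (hu : u =ᵐ[timeMeasure T] U) :
    U T = e := by
  obtain ⟨v, hv, hvu, rfl⟩ := h
  refine Measure.eqOn_Icc_of_ae_eq volume hT.ne ?_ hU hv (right_mem_Icc.2 hT.le)
  rw [← restrict_Ioo_eq_restrict_Icc]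
  exact (hvu.trans hu).symm

theorem HasFinalValue.sub {T : ℝ} {u₁ u₂ : ℝ → E} {e₁ e₂ : E}
    (h₁ : HasFinalValue T u₁ e₁) (h₂ : HasFinalValue T u₂ e₂) :
    HasFinalValue T (fun t => u₁ t - u₂ t) (e₁ - e₂) := by
  obtain ⟨v₁, hv₁, hvu₁, rfl⟩ := h₁
  obtain ⟨v₂, hv₂, hvu₂, rfl⟩ := h₂
  exact ⟨fun t => v₁ t - v₂ t, hv₁.sub hv₂, hvu₁.sub hvu₂, rfl⟩

end WeakDerivative

/-! ### Yosida approximation and the energy inequality -/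

section Energy

open Filter Topology

variable {V H : Type*} [NormedAddCommGroup V] [InnerProductSpace ℝ V]
  [NormedAddCommGroup H] [InnerProductSpace ℝ H]

/-- The real inner product as a bounded bilinear map. -/
noncomputable def realInnerL (H : Type*) [NormedAddCommGroup H] [InnerProductSpace ℝ H] :
    H →L[ℝ] H →L[ℝ] ℝ :=
  (isBoundedBilinearMap_inner (𝕜 := ℝ) (E := H)).toContinuousLinearMap

@[simp]
theorem realInnerL_apply (x y : H) : realInnerL H x y = ⟪x, y⟫_ℝ := rfl

@[simp]
theorem toDualV_apply (j : V →L[ℝ] H) (h : H) (v : V) : toDualV j h v = ⟪h, j v⟫_ℝ := rfl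

/-- `R` is the resolvent `h ↦ (1 + ε B)⁻¹ h` of `B : V → V*`, seen as an operator `H → V`. -/
def IsFormResolvent (j : V →L[ℝ] H) (B : V →L[ℝ] StrongDual ℝ V) (ε : ℝ) (R : H →L[ℝ] V) : Prop :=
  ∀ h v, ⟪j (R h), j v⟫_ℝ + ε * B (R h) v = ⟪h, j v⟫_ℝ

/-- Lax–Milgram for the coercive form (jv, jw) + ε B(v, w), composed with the adjoint of `j`. -/
theorem exists_isFormResolvent [CompleteSpace V] [CompleteSpace H] (j : V →L[ℝ] H)
    (B : V →L[ℝ] StrongDual ℝ V) {α : ℝ} (hα : 0 < α) (hB : ∀ w, α * ‖w‖ ^ 2 ≤ B w w)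
    {ε : ℝ} (hε : 0 < ε) : ∃ R : H →L[ℝ] V, IsFormResolvent j B ε R := by
  set a : V →L[ℝ] V →L[ℝ] ℝ := (realInnerL H).bilinearComp j j + ε • B with ha
  have hav : ∀ v w, a v w = ⟪j v, j w⟫_ℝ + ε * B v w := fun v w => by simp [ha]
  have hc : IsCoercive a := ⟨ε * α, by positivity, fun u => by
    rw [hav, real_inner_self_eq_norm_sq]
    nlinarith [hB u, sq_nonneg ‖j u‖]⟩
  refine ⟨(hc.continuousLinearEquivOfBilin.symm : V →L[ℝ] V).comp j.adjoint, fun h v => ?_⟩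
  rw [← hav, ← hc.continuousLinearEquivOfBilin_apply]
  simp [ContinuousLinearMap.adjoint_inner_left]

namespace IsFormResolvent

variable {j : V →L[ℝ] H} {B : V →L[ℝ] StrongDual ℝ V} {ε α : ℝ} {R : H →L[ℝ] V}

theorem eq_apply (hR : IsFormResolvent j B ε R) (hα : 0 < α) (hB : ∀ w, α * ‖w‖ ^ 2 ≤ B w w)
    (hε : 0 < ε) {y : V} {h : H} (hy : ∀ v, ⟪j y, j v⟫_ℝ + ε * B y v = ⟪h, j v⟫_ℝ) :
    R h = y := by
  have h1 := hR h (R h - y)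
  have h2 := hy (R h - y)
  have h3 : ⟪j (R h - y), j (R h - y)⟫_ℝ + ε * B (R h - y) (R h - y) = 0 := by
    rw [map_sub B, map_sub j, inner_sub_left, _root_.sub_apply, ← map_sub j]
    linarith
  rw [real_inner_self_eq_norm_sq] at h3
  have h4 : ‖R h - y‖ ^ 2 ≤ 0 := by
    have := mul_le_mul_of_nonneg_left (hB (R h - y)) hε.le
    have h5 : 0 < ε * α := by positivity
    nlinarith [sq_nonneg ‖j (R h - y)‖]
  have h5 : ‖R h - y‖ = 0 := by nlinarith [norm_nonneg (R h - y)]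
  exact sub_eq_zero.1 (norm_eq_zero.1 h5)

/-- When Bw = f lies in `H`, this says that the Yosida approximation ε⁻¹(jw - jR(jw)) of Bw equals
jRf. -/
theorem apply_of_form_eq (hR : IsFormResolvent j B ε R) (hα : 0 < α)
    (hB : ∀ w, α * ‖w‖ ^ 2 ≤ B w w) (hε : 0 < ε) {w : V} {f : H}
    (hw : B w = toDualV j f) : R (j w) = w - ε • R f := by
  refine hR.eq_apply hα hB hε fun v => ?_
  have h1 := hR f v
  have h2 : B w v = ⟪f, j v⟫_ℝ := by rw [hw]; rfl
  simp only [map_sub, map_smul, inner_sub_left, real_inner_smul_left, _root_.sub_apply,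
    _root_.smul_apply, smul_eq_mul]
  linear_combination (-ε) * h1 + ε * h2

theorem norm_apply_le (hR : IsFormResolvent j B ε R) (hα : 0 < α)
    (hB : ∀ w, α * ‖w‖ ^ 2 ≤ B w w) (hε : 0 < ε) (h : H) : ‖j (R h)‖ ≤ ‖h‖ := by
  have h1 := hR h (R h)
  rw [real_inner_self_eq_norm_sq] at h1
  have h2 := real_inner_le_norm h (j (R h))
  have h3 : 0 ≤ ε * B (R h) (R h) :=
    mul_nonneg hε.le ((by positivity : 0 ≤ α * ‖R h‖ ^ 2).trans (hB _))
  by_contra hlt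
  push Not at hlt
  nlinarith [norm_nonneg h]

theorem inner_symm (hR : IsFormResolvent j B ε R) (hBs : ∀ v w, B v w = B w v) (h k : H) :
    ⟪j (R h), k⟫_ℝ = ⟪j (R k), h⟫_ℝ := by
  have h1 := hR k (R h)
  have h2 := hR h (R k)
  rw [hBs, real_inner_comm (j (R h))] at h1
  rw [real_inner_comm, real_inner_comm h]
  linarith

/-- With z = R(jv) - v one has ‖jz‖² + ε B(z,z) = -ε B(v,z). Young's inequality leaves a term
εα‖z‖², which coercivity absorbs. The estimate gives convergence at the points of jV. -/
theorem norm_apply_sub_sq_le (hR : IsFormResolvent j B ε R) (hα : 0 < α)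
    (hB : ∀ w, α * ‖w‖ ^ 2 ≤ B w w) (hε : 0 < ε) (v : V) :
    ‖j (R (j v)) - j v‖ ^ 2 ≤ ε * (‖B v‖ ^ 2 / α) := by
  set z := R (j v) - v with hz
  have h1 := hR (j v) z
  have h2 : ⟪j z, j z⟫_ℝ + ε * B z z = - ε * B v z := by
    have : B z = B (R (j v)) - B v := by rw [hz, map_sub]
    rw [this, _root_.sub_apply]
    have : ⟪j z, j z⟫_ℝ = ⟪j (R (j v)), j z⟫_ℝ - ⟪j v, j z⟫_ℝ := by
      rw [← inner_sub_left, ← map_sub]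
    rw [this]
    linarith
  rw [real_inner_self_eq_norm_sq] at h2
  have h3 : - B v z ≤ ‖B v‖ * ‖z‖ := by
    have := (B v).le_opNorm z
    rw [Real.norm_eq_abs] at this
    exact (neg_le_abs _).trans this
  have h4 : ‖B v‖ * ‖z‖ ≤ ‖B v‖ ^ 2 / α + α * ‖z‖ ^ 2 := by
    have h : ‖B v‖ ^ 2 / α + α * ‖z‖ ^ 2 - ‖B v‖ * ‖z‖ =
        ((‖B v‖ - α * ‖z‖) ^ 2 + ‖B v‖ ^ 2 + (α * ‖z‖) ^ 2) / (2 * α) := by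
      field_simp
      ring
    have : 0 ≤ ((‖B v‖ - α * ‖z‖) ^ 2 + ‖B v‖ ^ 2 + (α * ‖z‖) ^ 2) / (2 * α) := by positivity
    linarith
  rw [← map_sub, ← hz]
  nlinarith [mul_le_mul_of_nonneg_left h3 hε.le, mul_le_mul_of_nonneg_left h4 hε.le,
    mul_le_mul_of_nonneg_left (hB z) hε.le]

/-- The Yosida approximation of the quadratic form of `B` is dominated by that form. -/
theorem yosida_le (hR : IsFormResolvent j B ε R) (hα : 0 < α)
    (hB : ∀ w, α * ‖w‖ ^ 2 ≤ B w w) (hBs : ∀ v w, B v w = B w v) (hε : 0 < ε) (v : V) :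
    ⟪ε⁻¹ • (j v - j (R (j v))), j v⟫_ℝ ≤ B v v := by
  have h1 := hR (j v) v
  have h2 := hR (j v) (v - R (j v))
  have h3 : ⟪j v - j (R (j v)), j v⟫_ℝ = ε * B (R (j v)) v := by
    rw [inner_sub_left]; linarith
  rw [real_inner_smul_left, h3, ← mul_assoc, inv_mul_cancel₀ hε.ne', one_mul]
  set y := R (j v)
  -- With y = R(jv), the Yosida form at v is B(y,v). The difference B(v,v) - B(y,v) is the sum of
  -- B(v-y,v-y) and B(y,v-y) = ε⁻¹‖j(v-y)‖², both nonnegative.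
  have h4 : 0 ≤ B (v - y) (v - y) := (by positivity : 0 ≤ α * ‖v - y‖ ^ 2).trans (hB _)
  have h5 : ε * B y (v - y) = ⟪j (v - y), j (v - y)⟫_ℝ := by
    have : ⟪j (v - y), j (v - y)⟫_ℝ = ⟪j v, j (v - y)⟫_ℝ - ⟪j y, j (v - y)⟫_ℝ := by
      rw [← inner_sub_left, ← map_sub]
    rw [this]; linarith
  have h6 : 0 ≤ B y (v - y) := by
    have : 0 ≤ ε * B y (v - y) := by rw [h5]; exact real_inner_self_nonneg
    exact nonneg_of_mul_nonneg_right this hε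
  have h7 : B (v - y) (v - y) = B v v - B y v - B y (v - y) := by
    simp only [map_sub, _root_.sub_apply]
    rw [hBs v y]
  linarith

/-- Convergence holds on the dense range of `j` and extends to `H` because every j ∘ R is a
contraction. -/
theorem tendsto_apply {R : ℕ → H →L[ℝ] V} (hj : DenseRange j) (hα : 0 < α)
    (hB : ∀ w, α * ‖w‖ ^ 2 ≤ B w w)
    (hR : ∀ n : ℕ, IsFormResolvent j B (1 / ((n : ℝ) + 1)) (R n)) (h : H) :
    Tendsto (fun n => j (R n h)) atTop (𝓝 h) := by
  have hpos : ∀ n : ℕ, (0 : ℝ) < 1 / ((n : ℝ) + 1) := fun n => Nat.one_div_pos_of_nat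
  have hd : ∀ v, Tendsto (fun n => ‖j (R n (j v)) - j v‖) atTop (𝓝 0) := fun v => by
    have h1 : Tendsto (fun n : ℕ => √(1 / ((n : ℝ) + 1) * (‖B v‖ ^ 2 / α))) atTop (𝓝 0) := by
      have := (tendsto_one_div_add_atTop_nhds_zero_nat (𝕜 := ℝ)).mul_const (‖B v‖ ^ 2 / α)
      rw [zero_mul] at this
      simpa using this.sqrt
    exact squeeze_zero (fun n => norm_nonneg _) (fun n => Real.le_sqrt_of_sq_le
      ((hR n).norm_apply_sub_sq_le hα hB (hpos n) v)) h1
  rw [Metric.tendsto_atTop]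
  intro δ hδ
  obtain ⟨v, hv⟩ := hj.exists_dist_lt h (show 0 < δ / 3 by positivity)
  obtain ⟨N, hN⟩ := Metric.tendsto_atTop.1 (hd v) (δ / 3) (by positivity)
  refine ⟨N, fun n hn => ?_⟩
  have h1 := hN n hn
  rw [dist_zero_right, norm_norm] at h1
  have h2 := (hR n).norm_apply_le hα hB (hpos n) (h - j v)
  rw [dist_eq_norm] at hv ⊢
  have h3 : j (R n h) - h = j (R n (h - j v)) + (j (R n (j v)) - j v) - (h - j v) := by
    simp only [map_sub]; abel
  rw [h3]
  calc _ ≤ ‖j (R n (h - j v)) + (j (R n (j v)) - j v)‖ + ‖h - j v‖ := norm_sub_le _ _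
    _ ≤ ‖j (R n (h - j v))‖ + ‖j (R n (j v)) - j v‖ + ‖h - j v‖ := by gcongr; exact norm_add_le _ _
    _ < δ := by linarith

end IsFormResolvent

/-- If `w(t)` is given by integrating `g ∈ L²(0,T;H)` backwards from `wT ∈ V`, and
`B w = f ∈ L²(0,T;H)`, then `⟨B w, w⟩` satisfies the energy inequality. -/
theorem form_energy_le [CompleteSpace V] [CompleteSpace H] {j : V →L[ℝ] H} (hj : DenseRange j)
    {B : V →L[ℝ] StrongDual ℝ V} {α : ℝ} (hα : 0 < α)
    (hB : ∀ w, α * ‖w‖ ^ 2 ≤ B w w) (hBs : ∀ v w, B v w = B w v) {T : ℝ} (hT : 0 < T)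
    {w : ℝ → V} {f g : ℝ → H} {wT : V} (hf : MemLp f 2 (timeMeasure T))
    (hg : MemLp g 2 (timeMeasure T))
    (hw : ∀ᵐ t ∂timeMeasure T, j (w t) = j wT - ∫ s in t..T, g s)
    (hBw : ∀ᵐ t ∂timeMeasure T, B (w t) = toDualV j (f t)) :
    ∀ᵐ a ∂timeMeasure T, B (w a) (w a) ≤ B wT wT - 2 * ∫ s in a..T, ⟪f s, g s⟫_ℝ := by
  have hgi := hg.intervalIntegrable_of_timeMeasure hT.le
  have hpos : ∀ n : ℕ, (0 : ℝ) < 1 / ((n : ℝ) + 1) := fun n => Nat.one_div_pos_of_nat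
  choose R hR using fun n : ℕ => exists_isFormResolvent j B hα hB (hpos n)
  have hfg : Integrable (fun t => ‖f t‖ * ‖g t‖) (timeMeasure T) :=
    hf.norm.integrable_mul hg.norm
  filter_upwards [hw, hBw, ae_restrict_mem measurableSet_Ioo] with a hwa hBwa ha
  have hTm : T ∈ Icc 0 T := right_mem_Icc.2 hT.le
  have ham : a ∈ Icc 0 T := Ioo_subset_Icc_self ha
  have hsub : Ioc a T ⊆ Ioc 0 T := Ioc_subset_Ioc_left ha.1.le
  have hrestr : volume.restrict (Ioc a T) ≤ timeMeasure T := by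
    rw [timeMeasure, restrict_Ioo_eq_restrict_Ioc]
    exact Measure.restrict_mono hsub le_rfl
  set U : ℝ → H := fun t => j wT - ∫ s in t..T, g s with hU
  have hUT : U T = j wT := by simp [hU]
  have hUa : ∀ t ∈ Icc a T, U t = U a + ∫ s in a..t, g s := fun t ht => by
    have htm : t ∈ Icc 0 T := ⟨ha.1.le.trans ht.1, ht.2⟩
    have := intervalIntegral.integral_add_adjacent_intervals
      (hgi.mono_of_mem_Icc ham htm) (hgi.mono_of_mem_Icc htm hTm)
    simp only [hU, ← this]; abel
  have hiden : ∀ n, ⟪j (R n (f a)), j (w a)⟫_ℝ ≤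
      B wT wT - 2 * ∫ s in a..T, ⟪j (R n (f s)), g s⟫_ℝ := by
    intro n
    set ε := 1 / ((n : ℝ) + 1)
    have hε : 0 < ε := hpos n
    -- The Yosida operator is bounded and symmetric on `H`, so the product rule applies to (YU, U)
    -- although U is differentiable only with values in `H`.
    set Y : H →L[ℝ] H := ε⁻¹ • (ContinuousLinearMap.id ℝ H - j.comp (R n)) with hY
    have hYa : ∀ h, Y h = ε⁻¹ • (h - j (R n h)) := fun h => rfl
    have hYs : ∀ h k, ⟪Y h, k⟫_ℝ = ⟪Y k, h⟫_ℝ := fun h k => by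
      simp only [hYa, real_inner_smul_left, inner_sub_left]
      rw [real_inner_comm k h, (hR n).inner_symm hBs h k]
    have hYw : ∀ v h, B v = toDualV j h → Y (j v) = j (R n h) := fun v h hv => by
      rw [hYa, (hR n).apply_of_form_eq hα hB hε hv, map_sub, map_smul, sub_sub_cancel, smul_smul,
        inv_mul_cancel₀ hε.ne', one_smul]
    have key := integral_bilin_primitive ((realInnerL H).comp Y) ha.2.le
      (hgi.mono_of_mem_Icc ham hTm) (hgi.mono_of_mem_Icc ham hTm) hUa hUa
    simp only [ContinuousLinearMap.comp_apply, realInnerL_apply, hUT] at key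
    have h1 : ∫ t in a..T, ⟪Y (g t), U t⟫_ℝ = ∫ t in a..T, ⟪Y (U t), g t⟫_ℝ := by
      simp only [hYs (g _)]
    have h2 : ∫ t in a..T, ⟪Y (U t), g t⟫_ℝ = ∫ t in a..T, ⟪j (R n (f t)), g t⟫_ℝ := by
      simp only [intervalIntegral.integral_of_le ha.2.le]
      refine integral_congr_ae (ae_mono hrestr ?_)
      filter_upwards [hw, hBw] with t ht1 ht2
      rw [← hYw _ _ ht2, ht1]
    rw [h1, h2, show U a = j (w a) from hwa.symm, hYw _ _ hBwa] at key
    -- Only an inequality is available at the final time: the Yosida form at wT is at most B(wT,wT),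
    -- uniformly in n.
    have h3 := (hR n).yosida_le hα hB hBs hε wT
    rw [← hYa] at h3
    linarith
  have hlim1 : Tendsto (fun n => ⟪j (R n (f a)), j (w a)⟫_ℝ) atTop (𝓝 (B (w a) (w a))) := by
    have : B (w a) (w a) = ⟪f a, j (w a)⟫_ℝ := by rw [hBwa, toDualV_apply]
    rw [this]
    exact (IsFormResolvent.tendsto_apply hj hα hB hR (f a)).inner tendsto_const_nhds
  have hlim2 : Tendsto (fun n => ∫ s in a..T, ⟪j (R n (f s)), g s⟫_ℝ) atTop
      (𝓝 (∫ s in a..T, ⟪f s, g s⟫_ℝ)) := by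
    simp only [intervalIntegral.integral_of_le ha.2.le]
    refine tendsto_integral_of_dominated_convergence (fun t => ‖f t‖ * ‖g t‖) (fun n => ?_)
      (hfg.mono_measure hrestr) (fun n => ?_) ?_
    · exact (((j.comp (R n)).continuous.comp_aestronglyMeasurable hf.1).inner hg.1).mono_measure
        hrestr
    · refine Eventually.of_forall fun t => (norm_inner_le_norm _ _).trans ?_
      gcongr
      exact (hR n).norm_apply_le hα hB (hpos n) _
    · exact Eventually.of_forall fun t =>
        (IsFormResolvent.tendsto_apply hj hα hB hR (f t)).inner tendsto_const_nhds
  exact le_of_tendsto_of_tendsto' hlim1 (tendsto_const_nhds.sub (hlim2.const_mul 2)) hiden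

end Energy

/-! ### Measurability of t ↦ C(t)w(t) -/

section Measurability

open Filter Topology

variable {V H : Type*} [NormedAddCommGroup V] [InnerProductSpace ℝ V]
  [NormedAddCommGroup H] [InnerProductSpace ℝ H]

/-- Orthonormal vectors lie at distance √2, so balls of radius 1/2 about them are disjoint. -/
theorem Orthonormal.countable_index [TopologicalSpace.SeparableSpace H] {ι : Type*} {b : ι → H}
    (hb : Orthonormal ℝ b) : Countable ι := by
  refine Pairwise.countable_of_isOpen_disjoint (s := fun i => Metric.ball (b i) (1 / 2))
    (fun i k hik => Metric.ball_disjoint_ball ?_) (fun _ => Metric.isOpen_ball)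
    (fun i => ⟨b i, Metric.mem_ball_self (by norm_num)⟩)
  have h : ‖b i - b k‖ ^ 2 = 2 := by
    rw [norm_sub_sq_real, hb.1, hb.1, hb.2 hik]; norm_num
  rw [dist_eq_norm]
  nlinarith [norm_nonneg (b i - b k)]

/-- Pettis' theorem in a separable Hilbert space. -/
theorem aestronglyMeasurable_of_inner [TopologicalSpace.SeparableSpace H] [CompleteSpace H]
    {X : Type*} [MeasurableSpace X] {μ : Measure X} {D : X → H}
    (hD : ∀ h : H, AEMeasurable (fun t => ⟪D t, h⟫_ℝ) μ) : AEStronglyMeasurable D μ := by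
  obtain ⟨s, b, -⟩ := exists_hilbertBasis ℝ H
  -- Countability makes the filter of finite subsets countably generated, so the limit of the
  -- partial Fourier sums stays measurable.
  have : Countable s := b.orthonormal.countable_index
  refine aestronglyMeasurable_of_tendsto_ae (u := atTop)
    (f := fun (S : Finset s) t => ∑ i ∈ S, b.repr (D t) i • b i) (fun S => ?_)
    (Eventually.of_forall fun t => b.hasSum_repr (D t))
  refine Finset.aestronglyMeasurable_fun_sum _ fun i _ => ?_
  refine AEStronglyMeasurable.smul_const ?_ _
  simp only [b.repr_apply_apply, real_inner_comm (D _)]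
  simpa only [real_inner_comm] using (hD (b i)).aestronglyMeasurable

/-- For simple w the function is a finite sum of indicators times C(t)v; continuity of each C(t)
passes to the limit. No measurability of C in operator norm is needed. -/
theorem AEStronglyMeasurable.clm_family_apply {X : Type*} [MeasurableSpace X] {μ : Measure X}
    {C : X → V →L[ℝ] H} (hC : ∀ v, AEStronglyMeasurable (fun t => C t v) μ) {w : X → V}
    (hw : AEStronglyMeasurable w μ) : AEStronglyMeasurable (fun t => C t (w t)) μ := by
  obtain ⟨w', hw', hww'⟩ := hw
  refine AEStronglyMeasurable.congr (f := fun t => C t (w' t)) ?_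
    (hww'.mono fun t ht => by simp only [ht])
  refine aestronglyMeasurable_of_tendsto_ae (u := atTop)
    (f := fun (n : ℕ) t => C t (hw'.approx n t)) (fun n => ?_)
    (Eventually.of_forall fun t => ((C t).continuous.tendsto _).comp (hw'.tendsto_approx t))
  generalize hw'.approx n = s
  have h : (fun t => C t (s t)) =
      fun t => ∑ v ∈ s.range, (s ⁻¹' {v}).indicator (fun t => C t v) t := by
    funext t
    rw [Finset.sum_eq_single (s t)]
    · simp
    · intro v _ hv
      exact indicator_of_notMem (fun h => hv h.symm) _
    · intro h
      exact absurd (s.mem_range_self t) h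
  rw [h]
  exact Finset.aestronglyMeasurable_fun_sum _ fun v _ =>
    (hC v).indicator (s.measurableSet_fiber v)

theorem MeasureTheory.MemLp.clm_family_apply {X : Type*} [MeasurableSpace X] {μ : Measure X}
    {C : X → V →L[ℝ] H} (hC : ∀ v, AEStronglyMeasurable (fun t => C t v) μ) {K : ℝ}
    (hK : ∀ᵐ t ∂μ, ∀ v, ‖C t v‖ ≤ K * ‖v‖) {p : ENNReal} {w : X → V}
    (hw : MemLp w p μ) : MemLp (fun t => C t (w t)) p μ :=
  hw.of_le_mul (AEStronglyMeasurable.clm_family_apply hC hw.1) (hK.mono fun _ ht => ht _)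

end Measurability

/-! ### Gronwall's lemma and uniqueness -/

section Uniqueness

variable {V H : Type*} [NormedAddCommGroup V] [InnerProductSpace ℝ V]
  [NormedAddCommGroup H] [InnerProductSpace ℝ H]

/-- An integral form of Gronwall's lemma, backwards in time and for bounded functions. -/
theorem ae_nonpos_of_le_integral_tail {T : ℝ} {c M : ℝ} (hc : 0 ≤ c) {y : ℝ → ℝ}
    (hy0 : ∀ t, 0 ≤ y t)
    (hym : AEStronglyMeasurable y (timeMeasure T)) (hM : ∀ᵐ t ∂timeMeasure T, y t ≤ M)
    (h : ∀ᵐ t ∂timeMeasure T, y t ≤ c * ∫ s in t..T, y s) :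
    ∀ᵐ t ∂timeMeasure T, y t ≤ 0 := by
  have hyi : Integrable y (timeMeasure T) := Integrable.of_bound hym M
    (hM.mono fun t ht => by rwa [Real.norm_of_nonneg (hy0 t)])
  -- Iterating the hypothesis bounds y by M times the n-th term of the exponential series, which
  -- tends to 0.
  have hn : ∀ n : ℕ, ∀ᵐ t ∂timeMeasure T, y t ≤ M * ((c * (T - t)) ^ n / n.factorial) := by
    intro n
    induction n with
    | zero => simpa using hM
    | succ n ih =>
      filter_upwards [h, ae_restrict_mem measurableSet_Ioo] with t ht htm
      refine ht.trans ?_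
      have hsub : Ioc t T ⊆ Ioc 0 T := Ioc_subset_Ioc_left htm.1.le
      have hrestr : volume.restrict (Ioc t T) ≤ timeMeasure T := by
        rw [timeMeasure, restrict_Ioo_eq_restrict_Ioc]
        exact Measure.restrict_mono hsub le_rfl
      have hcont : Continuous fun s : ℝ => M * ((c * (T - s)) ^ n / n.factorial) := by fun_prop
      have h1 : ∫ s in t..T, y s ≤ ∫ s in t..T, M * ((c * (T - s)) ^ n / n.factorial) := by
        refine intervalIntegral.integral_mono_ae_restrict htm.2.le ?_
          (hcont.intervalIntegrable _ _) ?_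
        · rw [intervalIntegrable_iff_integrableOn_Ioc_of_le htm.2.le]
          exact hyi.mono_measure hrestr
        · rw [Filter.EventuallyLE, ← restrict_Ioc_eq_restrict_Icc]
          exact ae_mono hrestr ih
      have h2 : ∫ s in t..T, M * ((c * (T - s)) ^ n / n.factorial) =
          M * (c ^ n * ((T - t) ^ (n + 1) / (n + 1)) / n.factorial) := by
        simp only [mul_pow]
        rw [intervalIntegral.integral_const_mul, intervalIntegral.integral_div,
          intervalIntegral.integral_const_mul,
          intervalIntegral.integral_comp_sub_left (fun s => s ^ n)]
        simp
      calc c * ∫ s in t..T, y s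
          ≤ c * (M * (c ^ n * ((T - t) ^ (n + 1) / (n + 1)) / n.factorial)) := by
            rw [← h2]; gcongr
        _ = M * ((c * (T - t)) ^ (n + 1) / (n + 1).factorial) := by
            rw [Nat.factorial_succ, mul_pow]; push_cast
            field_simp
            ring
  filter_upwards [ae_all_iff.2 hn] with t ht
  have hl := (FloorSemiring.tendsto_pow_div_factorial_atTop (c * (T - t))).const_mul M
  rw [mul_zero] at hl
  exact ge_of_tendsto' hl ht

/-- Here g is the derivative of w and the final value is 0. The energy inequality gives α‖w(t)‖² ≤
-2∫_t^T (Ag - Cw, g), whose quadratic part in g is controlled by coercivity of `A`. -/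
theorem form_solution_eq_zero [CompleteSpace V] [CompleteSpace H] {j : V →L[ℝ] H}
    (hj : DenseRange j) {T : ℝ} (hT : 0 < T) {A : H →L[ℝ] H} {B : V →L[ℝ] StrongDual ℝ V}
    {C : ℝ → V →L[ℝ] H} {α K : ℝ} (hα : 0 < α) (hA : ∀ h, α * ‖h‖ ^ 2 ≤ ⟪A h, h⟫_ℝ)
    (hB : ∀ w, α * ‖w‖ ^ 2 ≤ B w w) (hBs : ∀ v w, B v w = B w v)
    (hC : ∀ᵐ t ∂timeMeasure T, ∀ v, ‖C t v‖ ≤ K * ‖v‖)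
    (hCm : ∀ v, AEStronglyMeasurable (fun t => C t v) (timeMeasure T))
    {w : ℝ → V} {g : ℝ → H} {M : ℝ} (hwm : AEStronglyMeasurable w (timeMeasure T))
    (hwM : ∀ᵐ t ∂timeMeasure T, ‖w t‖ ≤ M) (hg : MemLp g 2 (timeMeasure T))
    (hw : ∀ᵐ t ∂timeMeasure T, j (w t) = - ∫ s in t..T, g s)
    (heq : ∀ᵐ t ∂timeMeasure T, B (w t) = toDualV j (A (g t) - C t (w t))) :
    ∀ᵐ t ∂timeMeasure T, w t = 0 := by
  have hw2 : MemLp w 2 (timeMeasure T) := MemLp.of_bound hwm M hwM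
  have hCw : MemLp (fun t => C t (w t)) 2 (timeMeasure T) := hw2.clm_family_apply hCm hC
  have hf : MemLp (fun t => A (g t) - C t (w t)) 2 (timeMeasure T) :=
    (A.comp_memLp' hg).sub hCw
  have hen := form_energy_le hj hα hB hBs hT (wT := 0) hf hg (by simpa using hw) heq
  have hsq : Integrable (fun t => ‖w t‖ ^ 2) (timeMeasure T) := hw2.integrable_norm_pow (by simp)
  have hfg : Integrable (fun t => ⟪A (g t) - C t (w t), g t⟫_ℝ) (timeMeasure T) :=
    (hf.norm.integrable_mul hg.norm).mono' (hf.1.inner hg.1)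
      (.of_forall fun t => norm_inner_le_norm _ _)
  have hlow : ∀ᵐ t ∂timeMeasure T,
      - (K ^ 2 / (4 * α)) * ‖w t‖ ^ 2 ≤ ⟪A (g t) - C t (w t), g t⟫_ℝ := by
    filter_upwards [hC] with t ht
    rw [inner_sub_left]
    have h1 := real_inner_le_norm (C t (w t)) (g t)
    have h2 : ‖C t (w t)‖ * ‖g t‖ ≤ K * ‖w t‖ * ‖g t‖ := by gcongr; exact ht _
    -- Young's inequality with weights leaving exactly α‖g‖², which (Ag, g) compensates.
    have h3 : K * ‖w t‖ * ‖g t‖ ≤ K ^ 2 / (4 * α) * ‖w t‖ ^ 2 + α * ‖g t‖ ^ 2 := by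
      have : K ^ 2 / (4 * α) * ‖w t‖ ^ 2 + α * ‖g t‖ ^ 2 - K * ‖w t‖ * ‖g t‖ =
          (K * ‖w t‖ - 2 * α * ‖g t‖) ^ 2 / (4 * α) := by
        field_simp; ring
      have h0 : 0 ≤ (K * ‖w t‖ - 2 * α * ‖g t‖) ^ 2 / (4 * α) := by positivity
      linarith
    linarith [hA (g t)]
  have hy : ∀ᵐ t ∂timeMeasure T, ‖w t‖ ^ 2 ≤ K ^ 2 / (2 * α ^ 2) * ∫ s in t..T, ‖w s‖ ^ 2 := by
    filter_upwards [hen, ae_restrict_mem measurableSet_Ioo] with t ht htm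
    have hrestr : volume.restrict (Ioc t T) ≤ timeMeasure T := by
      rw [timeMeasure, restrict_Ioo_eq_restrict_Ioc]
      exact Measure.restrict_mono (Ioc_subset_Ioc_left htm.1.le) le_rfl
    have h1 : ∫ s in t..T, - (K ^ 2 / (4 * α)) * ‖w s‖ ^ 2 ≤
        ∫ s in t..T, ⟪A (g s) - C s (w s), g s⟫_ℝ := by
      simp only [intervalIntegral.integral_of_le htm.2.le]
      exact integral_mono_ae ((hsq.const_mul _).mono_measure hrestr) (hfg.mono_measure hrestr)
        (ae_mono hrestr hlow)
    rw [intervalIntegral.integral_const_mul] at h1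
    simp only [map_zero, zero_sub] at ht
    have h2 : α * ‖w t‖ ^ 2 ≤ K ^ 2 / (2 * α) * ∫ s in t..T, ‖w s‖ ^ 2 := by
      have : K ^ 2 / (2 * α) = 2 * (K ^ 2 / (4 * α)) := by field_simp; norm_num
      rw [this]
      linarith [hB (w t)]
    have h3 : K ^ 2 / (2 * α ^ 2) = α⁻¹ * (K ^ 2 / (2 * α)) := by field_simp
    rw [h3, mul_assoc, ← div_eq_inv_mul, le_div_iff₀ hα]
    linarith
  have := ae_nonpos_of_le_integral_tail (by positivity) (fun t => sq_nonneg ‖w t‖) hsq.1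
    (M := M ^ 2) (hwM.mono fun t ht => by gcongr) hy
  filter_upwards [this] with t ht
  have : ‖w t‖ = 0 := by nlinarith [norm_nonneg (w t)]
  exact norm_eq_zero.1 this

end Uniqueness

/-! ### Lions' projection theorem -/

section Lions

/-- Lions' variant of the projection theorem. -/
theorem exists_mem_closure_range_forall_inner_eq {X Y : Type*} [NormedAddCommGroup X]
    [InnerProductSpace ℝ X] [CompleteSpace X] [AddCommGroup Y] [Module ℝ Y]
    (ι M : Y →ₗ[ℝ] X) (ℓ : Y →ₗ[ℝ] ℝ) (q : Y → ℝ) {c D : ℝ} (hc : 0 < c) (hD : 0 ≤ D)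
    (hM : ∀ y, c * (‖ι y‖ ^ 2 + q y ^ 2) ≤ ⟪ι y, M y⟫_ℝ)
    (hℓ : ∀ y, |ℓ y| ≤ D * (‖ι y‖ + q y)) :
    ∃ x ∈ closure (range ι), ∀ y, ⟪x, M y⟫_ℝ = ℓ y := by
  -- Projecting `M` onto the closure of the range of ι does not change its pairings with ι y, and
  -- forces the solution into that closure.
  set Z : Submodule ℝ X := (LinearMap.range ι).topologicalClosure with hZ
  have hZc : IsClosed (Z : Set X) := Submodule.isClosed_topologicalClosure _
  have : CompleteSpace Z := hZc.completeSpace_coe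
  set P : X →L[ℝ] Z := Z.orthogonalProjectionOnto with hP
  have hιZ : ∀ y, ι y ∈ Z := fun y => Submodule.le_topologicalClosure _ ⟨y, rfl⟩
  have hPi : ∀ (z : Z) (x : X), ⟪z, P x⟫_ℝ = ⟪(z : X), x⟫_ℝ := fun z x => by
    rw [hP, Submodule.inner_orthogonalProjectionOnto_eq_of_mem_left]
  set N : Y →ₗ[ℝ] Z := (P : X →ₗ[ℝ] Z) ∘ₗ M with hN
  have hNapp : ∀ y, N y = P (M y) := fun y => rfl
  -- Coercivity bounds both c‖ι y‖ and c q(y) by ‖N y‖, which accounts for the factor 2.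
  have hbound : ∀ y, |ℓ y| ≤ 2 * D / c * ‖N y‖ := fun y => by
    have h1 : c * (‖ι y‖ ^ 2 + q y ^ 2) ≤ ‖ι y‖ * ‖N y‖ := by
      refine (hM y).trans ?_
      rw [← hPi ⟨ι y, hιZ y⟩ (M y)]
      exact real_inner_le_norm _ _
    have h2 : c * ‖ι y‖ ≤ ‖N y‖ := by
      rcases (norm_nonneg (ι y)).eq_or_lt with h | h
      · rw [← h]; simp
      · refine le_of_mul_le_mul_left ?_ h
        nlinarith [sq_nonneg (q y)]
    have h3 : c * q y ≤ ‖N y‖ := by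
      refine le_of_sq_le_sq ?_ (norm_nonneg _)
      have : c * (‖ι y‖ * ‖N y‖) ≤ ‖N y‖ * ‖N y‖ := by
        rw [← mul_assoc]; gcongr
      nlinarith [sq_nonneg ‖ι y‖, mul_le_mul_of_nonneg_left h1 hc.le,
        mul_nonneg (sq_nonneg c) (sq_nonneg ‖ι y‖)]
    refine (hℓ y).trans ?_
    rw [div_mul_eq_mul_div, le_div_iff₀ hc]
    nlinarith
  have hker : LinearMap.ker N ≤ LinearMap.ker ℓ := fun y hy => by
    have h := hbound y
    rw [LinearMap.mem_ker.1 hy, norm_zero, mul_zero] at h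
    exact LinearMap.mem_ker.2 (abs_nonpos_iff.1 h)
  -- By the bound, ℓ factors through N as a bounded functional on its range; Hahn–Banach and Riesz
  -- then represent it by an element of Z.
  set L : LinearMap.range N →ₗ[ℝ] ℝ :=
    (LinearMap.ker N).liftQ ℓ hker ∘ₗ N.quotKerEquivRange.symm.toLinearMap with hL
  have hLN : ∀ y, L ⟨N y, y, rfl⟩ = ℓ y := fun y => by
    have : N.quotKerEquivRange.symm ⟨N y, y, rfl⟩ = (LinearMap.ker N).mkQ y := by
      rw [LinearEquiv.symm_apply_eq]; rfl
    simp only [hL, LinearMap.comp_apply, LinearEquiv.coe_coe, this]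
    rfl
  set Lc : StrongDual ℝ (LinearMap.range N) := L.mkContinuous (2 * D / c) (by
    rintro ⟨_, y, rfl⟩
    rw [hLN]
    exact hbound y)
  obtain ⟨g, hg, -⟩ := _root_.exists_extension_norm_eq _ Lc
  set z : Z := (InnerProductSpace.toDual ℝ Z).symm g
  refine ⟨z, z.2, fun y => ?_⟩
  rw [← hPi, InnerProductSpace.toDual_symm_apply, ← hLN y]
  exact hg ⟨N y, y, rfl⟩

end Lions

/-! ### Operators on L²(0,T) -/

section LpOperators

variable {V H : Type*} [NormedAddCommGroup V] [InnerProductSpace ℝ V]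
  [NormedAddCommGroup H] [InnerProductSpace ℝ H]

/-- A bounded strongly measurable family of operators acts on `L²`. -/
theorem exists_Lp_clm_family {X : Type*} [MeasurableSpace X] {μ : Measure X}
    {C : X → V →L[ℝ] H} (hC : ∀ v, AEStronglyMeasurable (fun t => C t v) μ) {K : ℝ}
    (hK : ∀ᵐ t ∂μ, ∀ v, ‖C t v‖ ≤ K * ‖v‖) :
    ∃ L : Lp V 2 μ →L[ℝ] Lp H 2 μ, ∀ w, L w =ᵐ[μ] fun t => C t (w t) := by
  have hmem : ∀ w : Lp V 2 μ, MemLp (fun t => C t (w t)) 2 μ := fun w =>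
    (Lp.memLp w).clm_family_apply hC hK
  let L : Lp V 2 μ →ₗ[ℝ] Lp H 2 μ :=
    { toFun := fun w => (hmem w).toLp
      map_add' := fun v w => by
        rw [← MemLp.toLp_add]
        refine MemLp.toLp_congr _ _ ((Lp.coeFn_add v w).mono fun t ht => ?_)
        simp only [ht, Pi.add_apply, map_add]
      map_smul' := fun c w => by
        rw [RingHom.id_apply, ← MemLp.toLp_const_smul]
        refine MemLp.toLp_congr _ _ ((Lp.coeFn_smul c w).mono fun t ht => ?_)
        simp only [ht, Pi.smul_apply, map_smul] }
  refine ⟨L.mkContinuous K fun w => ?_, fun w => (hmem w).coeFn_toLp⟩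
  refine Lp.norm_le_mul_norm_of_ae_le_mul ?_
  filter_upwards [(hmem w).coeFn_toLp, hK] with t h1 h2
  exact h1 ▸ h2 _

theorem integral_tail_congr {T : ℝ} {f g : ℝ → V} (h : f =ᵐ[timeMeasure T] g) {t : ℝ}
    (ht : t ∈ Icc 0 T) : ∫ s in t..T, f s = ∫ s in t..T, g s := by
  simp only [intervalIntegral.integral_of_le ht.2]
  refine integral_congr_ae (ae_mono ?_ h)
  rw [timeMeasure, restrict_Ioo_eq_restrict_Ioc]
  exact Measure.restrict_mono (Ioc_subset_Ioc_left ht.1) le_rfl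

theorem integral_tail_eq {T : ℝ} {f : ℝ → V} (hf : IntervalIntegrable f volume 0 T) {t : ℝ}
    (ht : t ∈ Icc 0 T) :
    ∫ s in t..T, f s = (∫ s in 0..T, f s) + ∫ s in 0..t, - f s := by
  have h0 : (0 : ℝ) ∈ Icc 0 T := ⟨le_rfl, ht.1.trans ht.2⟩
  have hT : T ∈ Icc 0 T := ⟨ht.1.trans ht.2, le_rfl⟩
  rw [intervalIntegral.integral_neg, ← intervalIntegral.integral_add_adjacent_intervals
    (hf.mono_of_mem_Icc h0 ht) (hf.mono_of_mem_Icc ht hT)]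
  abel

theorem continuousOn_integral_tail {T : ℝ} (hT : 0 ≤ T) {f : ℝ → V}
    (hf : IntervalIntegrable f volume 0 T) :
    ContinuousOn (fun t => ∫ s in t..T, f s) (Icc 0 T) :=
  continuousOn_of_eq_primitive hf.neg hT fun _ ht => integral_tail_eq hf ht

/-- Integration from `t` to `T` is a bounded operator on `L²(0,T)`. -/
theorem exists_Lp_integral_tail {T : ℝ} (hT : 0 ≤ T) :
    ∃ S : Lp V 2 (timeMeasure T) →L[ℝ] Lp V 2 (timeMeasure T),
      ∀ ψ, S ψ =ᵐ[timeMeasure T] fun t => ∫ s in t..T, ψ s := by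
  have hi : ∀ ψ : Lp V 2 (timeMeasure T), IntervalIntegrable ψ volume 0 T := fun ψ =>
    (Lp.memLp ψ).intervalIntegrable_of_timeMeasure hT
  have hTm : T ∈ Icc 0 T := right_mem_Icc.2 hT
  have hmem : ∀ ψ : Lp V 2 (timeMeasure T),
      MemLp (fun t => ∫ s in t..T, ψ s) 2 (timeMeasure T) := fun ψ =>
    (continuousOn_integral_tail hT (hi ψ)).memLp_timeMeasure 2
  let S : Lp V 2 (timeMeasure T) →ₗ[ℝ] Lp V 2 (timeMeasure T) :=
    { toFun := fun ψ => (hmem ψ).toLp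
      map_add' := fun v w => by
        rw [← MemLp.toLp_add]
        refine MemLp.toLp_congr _ _ ?_
        filter_upwards [ae_restrict_mem measurableSet_Ioo] with t ht
        have ht' := Ioo_subset_Icc_self ht
        rw [integral_tail_congr (Lp.coeFn_add v w) ht']
        exact intervalIntegral.integral_add ((hi v).mono_of_mem_Icc ht' hTm)
          ((hi w).mono_of_mem_Icc ht' hTm)
      map_smul' := fun c w => by
        rw [RingHom.id_apply, ← MemLp.toLp_const_smul]
        refine MemLp.toLp_congr _ _ ?_
        filter_upwards [ae_restrict_mem measurableSet_Ioo] with t ht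
        rw [integral_tail_congr (Lp.coeFn_smul c w) (Ioo_subset_Icc_self ht)]
        exact intervalIntegral.integral_smul c _ }
  -- Cauchy–Schwarz against the constant 1 bounds the tail integral uniformly in t; a second factor
  -- ‖1‖ comes from the L² norm in t.
  set one : Lp ℝ 2 (timeMeasure T) := (memLp_const (1 : ℝ)).toLp
  have hb : ∀ (ψ : Lp V 2 (timeMeasure T)), ∀ t ∈ Ioo 0 T, ‖∫ s in t..T, ψ s‖ ≤ ‖one‖ * ‖ψ‖ := by
    intro ψ t ht
    have h1 : ‖∫ s in t..T, ψ s‖ ≤ ∫ s in Ioo 0 T, ‖ψ s‖ := by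
      refine (intervalIntegral.norm_integral_le_integral_norm ht.2.le).trans ?_
      rw [intervalIntegral.integral_of_le ht.2.le, ← integral_Ioc_eq_integral_Ioo]
      refine setIntegral_mono_set ?_ (Filter.Eventually.of_forall fun _ => norm_nonneg _)
        (Ioc_subset_Ioc_left ht.1.le).eventuallyLE
      exact ((intervalIntegrable_iff_integrableOn_Ioc_of_le hT).1 (hi ψ)).norm
    set nψ : Lp ℝ 2 (timeMeasure T) := (Lp.memLp ψ).norm.toLp with hn
    have h2 : ∫ s, ‖ψ s‖ ∂timeMeasure T = ⟪one, nψ⟫_ℝ := by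
      rw [L2.inner_def]
      refine integral_congr_ae ?_
      filter_upwards [(memLp_const (μ := timeMeasure T) (p := 2) (1 : ℝ)).coeFn_toLp,
        (Lp.memLp ψ).norm.coeFn_toLp] with s h1 h2
      rw [h1, h2]; simp
    have h3 : ‖nψ‖ = ‖ψ‖ := by
      rw [hn, Lp.norm_toLp, eLpNorm_norm, Lp.norm_def]
    rw [← h3]
    exact (h1.trans h2.le).trans (real_inner_le_norm _ _)
  refine ⟨S.mkContinuous (‖one‖ * ‖one‖) fun ψ => ?_, fun ψ => (hmem ψ).coeFn_toLp⟩
  have h4 : ‖S ψ‖ ≤ (‖one‖ * ‖ψ‖) * ‖one‖ := by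
    refine Lp.norm_le_mul_norm_of_ae_le_mul ?_
    filter_upwards [(hmem ψ).coeFn_toLp,
      (memLp_const (μ := timeMeasure T) (p := 2) (1 : ℝ)).coeFn_toLp,
      ae_restrict_mem measurableSet_Ioo] with t h1 h2 ht
    have : (S ψ) t = ∫ s in t..T, ψ s := h1
    rw [this, h2]
    simpa using hb ψ t ht
  linarith

end LpOperators

/-! ### Exponentially weighted integration by parts -/

section Weighted

variable {V : Type*} [NormedAddCommGroup V] [InnerProductSpace ℝ V] [CompleteSpace V]

theorem integral_exp_mul_of_primitive {T k : ℝ} (hT : 0 ≤ T) {y y' : ℝ → ℝ}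
    (hy' : IntervalIntegrable y' volume 0 T)
    (hy : ∀ t ∈ Icc 0 T, y t = y 0 + ∫ s in 0..t, y' s) (hyT : y T = 0) :
    ∫ t in 0..T, Real.exp (k * t) * y' t =
      - y 0 - ∫ t in 0..T, k * Real.exp (k * t) * y t := by
  have hcont : Continuous fun t => k * Real.exp (k * t) := by fun_prop
  have hder : ∀ t, HasDerivAt (fun t => Real.exp (k * t)) (k * Real.exp (k * t)) t := fun t => by
    have := ((hasDerivAt_id t).const_mul k).exp
    simpa [mul_comm] using this
  have hexp : ∀ t ∈ Icc 0 T, Real.exp (k * t) =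
      Real.exp (k * 0) + ∫ s in 0..t, k * Real.exp (k * s) := fun t _ => by
    rw [intervalIntegral.integral_eq_sub_of_hasDerivAt (fun s _ => hder s)
      (hcont.intervalIntegrable _ _)]
    ring
  have key := integral_bilin_primitive (ContinuousLinearMap.mul ℝ ℝ) hT
    (hcont.intervalIntegrable 0 T) hy' hexp hy
  simp only [ContinuousLinearMap.mul_apply', hyT, mul_zero, Real.exp_zero, one_mul,
    zero_sub] at key
  linarith

/-- Trades ψ for its tail integral, so that only φ and φ(0) have to be controlled in `V`. -/
theorem integral_exp_mul_dual_tail {T k : ℝ} (hT : 0 ≤ T) {ψ : ℝ → V}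
    (hψ : IntervalIntegrable ψ volume 0 T) (l : StrongDual ℝ V) :
    ∫ t in 0..T, Real.exp (k * t) * l (ψ t) =
      l (∫ s in 0..T, ψ s) + ∫ t in 0..T, k * Real.exp (k * t) * l (∫ s in t..T, ψ s) := by
  have hl : IntervalIntegrable (fun t => l (ψ t)) volume 0 T :=
    ⟨l.integrable_comp hψ.1, l.integrable_comp hψ.2⟩
  have h := integral_exp_mul_of_primitive (k := k) hT (y := fun t => l (∫ s in t..T, ψ s))
    (y' := fun t => - l (ψ t)) hl.neg (fun t ht => by
      rw [integral_tail_eq hψ ht, map_add, intervalIntegral.integral_neg, map_neg,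
        intervalIntegral.integral_neg,
        l.intervalIntegral_comp_comm (hψ.mono_of_mem_Icc ⟨le_rfl, hT⟩ ht)]) (by simp)
  simp only [mul_neg, intervalIntegral.integral_neg] at h
  linarith

/-- By symmetry b(φ,φ) has derivative -2b(φ,ψ) for the tail integral φ, and φ(T) = 0; the weight
then produces a positive term proportional to k. -/
theorem integral_exp_mul_form_tail {T k : ℝ} (hT : 0 ≤ T) {ψ : ℝ → V}
    (hψ : IntervalIntegrable ψ volume 0 T) (b : V →L[ℝ] V →L[ℝ] ℝ) (hb : ∀ v w, b v w = b w v) :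
    ∫ t in 0..T, Real.exp (k * t) * b (∫ s in t..T, ψ s) (ψ t) =
      1 / 2 * b (∫ s in 0..T, ψ s) (∫ s in 0..T, ψ s) +
        ∫ t in 0..T, k / 2 * Real.exp (k * t) * b (∫ s in t..T, ψ s) (∫ s in t..T, ψ s) := by
  set φ : ℝ → V := fun t => ∫ s in t..T, ψ s with hφ
  have hφc : ContinuousOn φ (Icc 0 T) := continuousOn_integral_tail hT hψ
  have hbi : IntervalIntegrable (fun t => b (φ t) (ψ t)) volume 0 T :=
    IntervalIntegrable.clm_continuousOn b hT hφc hψ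
  have h := integral_exp_mul_of_primitive (k := k) hT (y := fun t => b (φ t) (φ t))
    (y' := fun t => - 2 * b (φ t) (ψ t)) (hbi.const_mul _) (fun t ht => by
      have h0 : (0 : ℝ) ∈ Icc 0 T := ⟨le_rfl, hT⟩
      have hsub : Icc 0 t ⊆ Icc 0 T := Icc_subset_Icc_right ht.2
      have hφt : ∀ s ∈ Icc 0 t, φ s = φ 0 + ∫ r in 0..s, - ψ r := fun s hs =>
        integral_tail_eq hψ (hsub hs)
      have hψt := (hψ.mono_of_mem_Icc h0 ht).neg
      have key := integral_bilin_primitive b ht.1 hψt hψt hφt hφt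
      have h1 : ∫ s in 0..t, b ((-ψ) s) (φ s) = ∫ s in 0..t, b (φ s) ((-ψ) s) := by
        simp only [hb ((-ψ) _)]
      rw [h1] at key
      simp only [Pi.neg_apply, map_neg, intervalIntegral.integral_neg] at key
      rw [intervalIntegral.integral_const_mul]
      linarith) (by simp [hφ])
  have h2 : ∫ t in 0..T, Real.exp (k * t) * (-2 * b (φ t) (ψ t)) =
      -2 * ∫ t in 0..T, Real.exp (k * t) * b (φ t) (ψ t) := by
    rw [← intervalIntegral.integral_const_mul]
    exact intervalIntegral.integral_congr fun t _ => by ring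
  have h3 : ∫ t in 0..T, k * Real.exp (k * t) * b (φ t) (φ t) =
      2 * ∫ t in 0..T, k / 2 * Real.exp (k * t) * b (φ t) (φ t) := by
    rw [← intervalIntegral.integral_const_mul]
    exact intervalIntegral.integral_congr fun t _ => by ring
  rw [h2, h3] at h
  have h4 : φ 0 = ∫ s in 0..T, ψ s := rfl
  rw [h4] at h
  linarith

end Weighted

/-! ### Coercivity and existence of a weak solution -/

section Existence

open Filter Topology

variable {V H : Type*} [NormedAddCommGroup V] [InnerProductSpace ℝ V]
  [NormedAddCommGroup H] [InnerProductSpace ℝ H]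

theorem integral_timeMeasure_eq {T : ℝ} (hT : 0 ≤ T) (f : ℝ → ℝ) :
    ∫ t, f t ∂timeMeasure T = ∫ t in 0..T, f t := by
  rw [intervalIntegral.integral_of_le hT, integral_Ioc_eq_integral_Ioo]

/-- Multiplication by a continuous function is a bounded operator on `L²(0,T)`. -/
theorem exists_Lp_mul {T : ℝ} {ρ : ℝ → ℝ} (hρ : Continuous ρ) :
    ∃ W : Lp H 2 (timeMeasure T) →L[ℝ] Lp H 2 (timeMeasure T),
      ∀ ψ, W ψ =ᵐ[timeMeasure T] fun t => ρ t • ψ t := by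
  obtain ⟨M, hM⟩ := isCompact_Icc.exists_bound_of_continuousOn
    (s := Icc 0 T) hρ.continuousOn
  exact exists_Lp_clm_family (C := fun t => ρ t • ContinuousLinearMap.id ℝ H) (K := M)
    (fun v => by
      simpa using hρ.aestronglyMeasurable.smul_const v)
    (by
      filter_upwards [ae_restrict_mem measurableSet_Ioo] with t ht v
      simp only [_root_.smul_apply, ContinuousLinearMap.id_apply, norm_smul]
      gcongr
      exact hM t (Ioo_subset_Icc_self ht))

/-- The weighted bilinear form of the problem is coercive on `ψ ↦ (ψ, ∫_t^T ψ)`. -/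
theorem weighted_form_coercive [CompleteSpace V] [CompleteSpace H] {j : V →L[ℝ] H} {T : ℝ}
    (hT : 0 < T) {A : H →L[ℝ] H} {B : V →L[ℝ] StrongDual ℝ V}
    {C : ℝ → V →L[ℝ] H} {α K : ℝ} (hα : 0 < α) (hA : ∀ h, α * ‖h‖ ^ 2 ≤ ⟪A h, h⟫_ℝ)
    (hB : ∀ w, α * ‖w‖ ^ 2 ≤ B w w) (hBs : ∀ v w, B v w = B w v)
    (hC : ∀ᵐ t ∂timeMeasure T, ∀ v, ‖C t v‖ ≤ K * ‖v‖)
    (hCm : ∀ v, AEStronglyMeasurable (fun t => C t v) (timeMeasure T))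
    {k : ℝ} (hk : k = 1 + K ^ 2 / α ^ 2) {ψ φ : ℝ → V} (hψ : MemLp ψ 2 (timeMeasure T))
    (hφ : φ = fun t => ∫ s in t..T, ψ s) :
    α / 2 * ((∫ t, ‖j (ψ t)‖ ^ 2 ∂timeMeasure T) + (∫ t, ‖φ t‖ ^ 2 ∂timeMeasure T) + ‖φ 0‖ ^ 2) ≤
      (∫ t, Real.exp (k * t) * ⟪A (j (ψ t)) + C t (φ t), j (ψ t)⟫_ℝ ∂timeMeasure T) +
        ∫ t, Real.exp (k * t) * B (φ t) (ψ t) ∂timeMeasure T := by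
  have hψi := hψ.intervalIntegrable_of_timeMeasure hT.le
  have hφc : ContinuousOn φ (Icc 0 T) := hφ ▸ continuousOn_integral_tail hT.le hψi
  have hφL : MemLp φ 2 (timeMeasure T) := hφc.memLp_timeMeasure 2
  have hjψ : MemLp (fun t => j (ψ t)) 2 (timeMeasure T) := j.comp_memLp' hψ
  have hG : MemLp (fun t => A (j (ψ t)) + C t (φ t)) 2 (timeMeasure T) :=
    (A.comp_memLp' hjψ).add (hφL.clm_family_apply hCm hC)
  have hexp : ContinuousOn (fun t => Real.exp (k * t)) (Icc 0 T) :=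
    Continuous.continuousOn (by fun_prop)
  have hexpL := hexp.memLp_timeMeasure ⊤
  have h1 := integral_exp_mul_form_tail (k := k) hT.le hψi B hBs
  have hφ0 : ∫ s in 0..T, ψ s = φ 0 := by rw [hφ]
  simp only [hφ0, ← congrFun hφ _] at h1
  rw [integral_timeMeasure_eq hT.le (fun t => Real.exp (k * t) * B (φ t) (ψ t)), h1,
    ← integral_timeMeasure_eq hT.le]
  have hi1 : Integrable (fun t => Real.exp (k * t) * ⟪A (j (ψ t)) + C t (φ t), j (ψ t)⟫_ℝ)
      (timeMeasure T) := by
    have : Integrable (fun t => ⟪A (j (ψ t)) + C t (φ t), j (ψ t)⟫_ℝ) (timeMeasure T) :=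
      (hG.norm.integrable_mul hjψ.norm).mono' (hG.1.inner hjψ.1)
        (.of_forall fun t => norm_inner_le_norm _ _)
    exact this.smul_of_top_right hexpL
  have hi2 : Integrable (fun t => k / 2 * Real.exp (k * t) * B (φ t) (φ t)) (timeMeasure T) := by
    have hcont : ContinuousOn (fun t => k / 2 * Real.exp (k * t) * B (φ t) (φ t)) (Icc 0 T) :=
      (continuousOn_const.mul hexp).mul
        ((B.continuous.comp_continuousOn hφc).clm_apply hφc)
    exact memLp_one_iff_integrable.1 (hcont.memLp_timeMeasure 1)
  have hi3 : Integrable (fun t => ‖j (ψ t)‖ ^ 2) (timeMeasure T) :=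
    hjψ.integrable_norm_pow (by simp)
  have hi4 : Integrable (fun t => ‖φ t‖ ^ 2) (timeMeasure T) :=
    hφL.integrable_norm_pow (by simp)
  have hmain : ∫ t, α / 2 * (‖j (ψ t)‖ ^ 2 + ‖φ t‖ ^ 2) ∂timeMeasure T ≤
      ∫ t, (Real.exp (k * t) * ⟪A (j (ψ t)) + C t (φ t), j (ψ t)⟫_ℝ +
        k / 2 * Real.exp (k * t) * B (φ t) (φ t)) ∂timeMeasure T := by
    refine integral_mono_ae ((hi3.add hi4).const_mul _) (hi1.add hi2) ?_
    filter_upwards [hC, ae_restrict_mem measurableSet_Ioo] with t ht htm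
    have hk0 : 0 ≤ k := by rw [hk]; positivity
    have hω : 1 ≤ Real.exp (k * t) := Real.one_le_exp (mul_nonneg hk0 htm.1.le)
    have h2 := abs_le.1 (abs_real_inner_le_norm (C t (φ t)) (j (ψ t)))
    have h3 : ‖C t (φ t)‖ * ‖j (ψ t)‖ ≤ K * ‖φ t‖ * ‖j (ψ t)‖ := by gcongr; exact ht _
    have h4 : K * ‖φ t‖ * ‖j (ψ t)‖ ≤ α / 2 * ‖j (ψ t)‖ ^ 2 + K ^ 2 / (2 * α) * ‖φ t‖ ^ 2 := by
      have h0 : 0 ≤ (K * ‖φ t‖ - α * ‖j (ψ t)‖) ^ 2 / (2 * α) := by positivity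
      have : α / 2 * ‖j (ψ t)‖ ^ 2 + K ^ 2 / (2 * α) * ‖φ t‖ ^ 2 - K * ‖φ t‖ * ‖j (ψ t)‖ =
          (K * ‖φ t‖ - α * ‖j (ψ t)‖) ^ 2 / (2 * α) := by
        field_simp; ring
      linarith
    -- The value of k is chosen for this: it pays for the Young remainder K²/(2α) and leaves α/2.
    have h5 : k / 2 * (α * ‖φ t‖ ^ 2) = α / 2 * ‖φ t‖ ^ 2 + K ^ 2 / (2 * α) * ‖φ t‖ ^ 2 := by
      rw [hk]; field_simp
    have h6 := mul_le_mul_of_nonneg_left (hB (φ t)) (by positivity : 0 ≤ k / 2)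
    have h7 : α / 2 * (‖j (ψ t)‖ ^ 2 + ‖φ t‖ ^ 2) ≤
        ⟪A (j (ψ t)) + C t (φ t), j (ψ t)⟫_ℝ + k / 2 * B (φ t) (φ t) := by
      rw [inner_add_left]
      linarith [hA (j (ψ t))]
    have h8 : 0 ≤ α / 2 * (‖j (ψ t)‖ ^ 2 + ‖φ t‖ ^ 2) := by positivity
    show α / 2 * (‖j (ψ t)‖ ^ 2 + ‖φ t‖ ^ 2) ≤
      Real.exp (k * t) * ⟪A (j (ψ t)) + C t (φ t), j (ψ t)⟫_ℝ +
        k / 2 * Real.exp (k * t) * B (φ t) (φ t)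
    -- The unweighted sum is nonnegative, so the weight e^{kt} ≥ 1 can only increase it.
    calc _ ≤ ⟪A (j (ψ t)) + C t (φ t), j (ψ t)⟫_ℝ + k / 2 * B (φ t) (φ t) := h7
      _ ≤ Real.exp (k * t) * (⟪A (j (ψ t)) + C t (φ t), j (ψ t)⟫_ℝ + k / 2 * B (φ t) (φ t)) :=
        le_mul_of_one_le_left (h8.trans h7) hω
      _ = _ := by ring
  rw [integral_add hi1 hi2, integral_const_mul, integral_add hi3 hi4] at hmain
  linarith [hB (φ 0)]

/-- Lions' theorem applied to the pair (p, w - wT), where p plays the role of -w'. Boundedness of w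
in `V` is not claimed here. -/
theorem exists_weak_solution [CompleteSpace V] [CompleteSpace H] {j : V →L[ℝ] H} {T : ℝ}
    (hT : 0 < T) {A : H →L[ℝ] H} {B : V →L[ℝ] StrongDual ℝ V}
    {C : ℝ → V →L[ℝ] H} {α K : ℝ} (hα : 0 < α) (hA : ∀ h, α * ‖h‖ ^ 2 ≤ ⟪A h, h⟫_ℝ)
    (hB : ∀ w, α * ‖w‖ ^ 2 ≤ B w w) (hBs : ∀ v w, B v w = B w v)
    (hC : ∀ᵐ t ∂timeMeasure T, ∀ v, ‖C t v‖ ≤ K * ‖v‖)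
    (hCm : ∀ v, AEStronglyMeasurable (fun t => C t v) (timeMeasure T))
    (F : Lp H 2 (timeMeasure T)) (wT : V) :
    ∃ (w : Lp V 2 (timeMeasure T)) (p : Lp H 2 (timeMeasure T)),
      (∀ᵐ t ∂timeMeasure T, j (w t) = j wT + ∫ s in t..T, p s) ∧
      ∀ᵐ t ∂timeMeasure T, B (w t) = toDualV j (F t - A (p t) - C t (w t)) := by
  set k : ℝ := 1 + K ^ 2 / α ^ 2 with hk
  have hk0 : 0 ≤ k := by positivity
  obtain ⟨𝒞, h𝒞⟩ := exists_Lp_clm_family hCm hC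
  obtain ⟨S, hS⟩ := exists_Lp_integral_tail (V := V) hT.le
  obtain ⟨SH, hSH⟩ := exists_Lp_integral_tail (V := H) hT.le
  obtain ⟨W, hW⟩ := exists_Lp_mul (H := V) (T := T) (ρ := fun t => Real.exp (k * t))
    (by fun_prop)
  obtain ⟨WH, hWH⟩ := exists_Lp_mul (H := H) (T := T) (ρ := fun t => Real.exp (k * t))
    (by fun_prop)
  obtain ⟨W', hW'⟩ := exists_Lp_mul (H := V) (T := T) (ρ := fun t => Real.exp (-(k * t)))
    (by fun_prop)
  set b : V →L[ℝ] V := InnerProductSpace.continuousLinearMapOfBilin (𝕜 := ℝ) B with hb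
  have hbB : ∀ v w, ⟪b v, w⟫_ℝ = B v w :=
    InnerProductSpace.continuousLinearMapOfBilin_apply (𝕜 := ℝ) B
  set J : Lp V 2 (timeMeasure T) →L[ℝ] Lp H 2 (timeMeasure T) :=
    j.compLpL 2 (timeMeasure T) with hJ
  set 𝒜 : Lp H 2 (timeMeasure T) →L[ℝ] Lp H 2 (timeMeasure T) :=
    A.compLpL 2 (timeMeasure T) with h𝒜
  set ℬ : Lp V 2 (timeMeasure T) →L[ℝ] Lp V 2 (timeMeasure T) :=
    b.compLpL 2 (timeMeasure T) with hℬ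
  have hJt : ∀ ψ, J ψ =ᵐ[timeMeasure T] fun t => j (ψ t) := fun ψ => j.coeFn_compLpL ψ
  have h𝒜t : ∀ ψ, 𝒜 ψ =ᵐ[timeMeasure T] fun t => A (ψ t) := fun ψ => A.coeFn_compLpL ψ
  have hℬt : ∀ ψ, ℬ ψ =ᵐ[timeMeasure T] fun t => b (ψ t) := fun ψ => b.coeFn_compLpL ψ
  set c : Lp V 2 (timeMeasure T) := (memLp_const wT).toLp with hc
  have hct : c =ᵐ[timeMeasure T] fun _ => wT := (memLp_const wT).coeFn_toLp
  have hψi : ∀ ψ : Lp V 2 (timeMeasure T), IntervalIntegrable ψ volume 0 T := fun ψ =>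
    (Lp.memLp ψ).intervalIntegrable_of_timeMeasure hT.le
  have hJW : ∀ ψ, J (W ψ) = WH (J ψ) := fun ψ => by
    refine Lp.ext ?_
    filter_upwards [hJt (W ψ), hWH (J ψ), hW ψ, hJt ψ] with t h1 h2 h3 h4
    rw [h1, h2, h3, h4, map_smul]
  have hWW' : ∀ ψ, W (W' ψ) = ψ := fun ψ => by
    refine Lp.ext ?_
    filter_upwards [hW (W' ψ), hW' ψ] with t h1 h2
    rw [h1, h2, smul_smul, ← Real.exp_add, add_neg_cancel, Real.exp_zero, one_smul]
  have hSJ : ∀ ψ, SH (J ψ) = J (S ψ) := fun ψ => by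
    refine Lp.ext ?_
    filter_upwards [hSH (J ψ), hJt (S ψ), hS ψ, ae_restrict_mem measurableSet_Ioo]
      with t h1 h2 h3 ht
    have htm := Ioo_subset_Icc_self ht
    rw [h1, h2, h3, integral_tail_congr (hJt ψ) htm, j.intervalIntegral_comp_comm]
    exact (hψi ψ).mono_of_mem_Icc htm (right_mem_Icc.2 hT.le)
  -- Pairing x = (p, u) with M ψ gives the left side of the equation for u, tested with e^{kt}ψ; ℓ
  -- collects F and the terms due to wT. On the range of ι, u is the tail integral of p.
  let X := WithLp 2 (Lp H 2 (timeMeasure T) × Lp V 2 (timeMeasure T))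
  let ι : Lp V 2 (timeMeasure T) →ₗ[ℝ] X :=
    (WithLp.linearEquiv 2 ℝ (Lp H 2 (timeMeasure T) × Lp V 2 (timeMeasure T))).symm.toLinearMap ∘ₗ
      (J.prod S).toLinearMap
  let M : Lp V 2 (timeMeasure T) →ₗ[ℝ] X :=
    (WithLp.linearEquiv 2 ℝ (Lp H 2 (timeMeasure T) × Lp V 2 (timeMeasure T))).symm.toLinearMap ∘ₗ
      ((𝒜.adjoint ∘L J ∘L W).prod (𝒞.adjoint ∘L J ∘L W + ℬ.adjoint ∘L W)).toLinearMap
  let ℓ : Lp V 2 (timeMeasure T) →ₗ[ℝ] ℝ :=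
    ((innerSL ℝ (F - 𝒞 c)).comp (J ∘L W) - (innerSL ℝ (ℬ c)).comp W).toLinearMap
  have hM : ∀ (x : X) ψ, ⟪x, M ψ⟫_ℝ = ⟪𝒜 x.fst + 𝒞 x.snd, J (W ψ)⟫_ℝ + ⟪ℬ x.snd, W ψ⟫_ℝ := by
    intro x ψ
    have h1 : ⟪x, M ψ⟫_ℝ = ⟪x.fst, 𝒜.adjoint (J (W ψ))⟫_ℝ +
        ⟪x.snd, 𝒞.adjoint (J (W ψ)) + ℬ.adjoint (W ψ)⟫_ℝ := rfl
    rw [h1, inner_add_right, ContinuousLinearMap.adjoint_inner_right,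
      ContinuousLinearMap.adjoint_inner_right, ContinuousLinearMap.adjoint_inner_right,
      inner_add_left]
    ring
  have hℓ : ∀ ψ, ℓ ψ = ⟪F - 𝒞 c, J (W ψ)⟫_ℝ - ⟪ℬ c, W ψ⟫_ℝ := fun ψ => rfl
  have hιsq : ∀ ψ, ‖ι ψ‖ ^ 2 = ‖J ψ‖ ^ 2 + ‖S ψ‖ ^ 2 := fun ψ =>
    WithLp.prod_norm_sq_eq_of_L2 _
  have hnsqH : ∀ f : Lp H 2 (timeMeasure T), ‖f‖ ^ 2 = ∫ t, ‖f t‖ ^ 2 ∂timeMeasure T :=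
      fun f => by
    rw [← real_inner_self_eq_norm_sq, L2.inner_def]
    simp only [real_inner_self_eq_norm_sq]
  have hnsqV : ∀ f : Lp V 2 (timeMeasure T), ‖f‖ ^ 2 = ∫ t, ‖f t‖ ^ 2 ∂timeMeasure T :=
      fun f => by
    rw [← real_inner_self_eq_norm_sq, L2.inner_def]
    simp only [real_inner_self_eq_norm_sq]
  have hcoer : ∀ ψ, α / 2 * (‖ι ψ‖ ^ 2 + ‖∫ s in 0..T, ψ s‖ ^ 2) ≤ ⟪ι ψ, M ψ⟫_ℝ := by
    intro ψ
    have h1 := weighted_form_coercive (j := j) hT hα hA hB hBs hC hCm hk (Lp.memLp ψ) rfl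
    have e1 : ‖J ψ‖ ^ 2 = ∫ t, ‖j (ψ t)‖ ^ 2 ∂timeMeasure T := by
      rw [hnsqH]
      exact integral_congr_ae ((hJt ψ).mono fun t ht => by simp only [ht])
    have e2 : ‖S ψ‖ ^ 2 = ∫ t, ‖∫ s in t..T, ψ s‖ ^ 2 ∂timeMeasure T := by
      rw [hnsqV]
      exact integral_congr_ae ((hS ψ).mono fun t ht => by simp only [ht])
    have e3 : ⟪𝒜 (J ψ) + 𝒞 (S ψ), J (W ψ)⟫_ℝ =
        ∫ t, Real.exp (k * t) * ⟪A (j (ψ t)) + C t (∫ s in t..T, ψ s), j (ψ t)⟫_ℝ ∂timeMeasure T := by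
      rw [L2.inner_def]
      refine integral_congr_ae ?_
      filter_upwards [Lp.coeFn_add (𝒜 (J ψ)) (𝒞 (S ψ)), h𝒜t (J ψ), h𝒞 (S ψ), hJt ψ, hS ψ,
        hJt (W ψ), hW ψ] with t h1 h2 h3 h4 h5 h6 h7
      rw [h1, Pi.add_apply, h2, h3, h4, h5, h6, h7, map_smul, real_inner_smul_right]
    have e4 : ⟪ℬ (S ψ), W ψ⟫_ℝ =
        ∫ t, Real.exp (k * t) * B (∫ s in t..T, ψ s) (ψ t) ∂timeMeasure T := by
      rw [L2.inner_def]
      refine integral_congr_ae ?_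
      filter_upwards [hℬt (S ψ), hS ψ, hW ψ] with t h1 h2 h3
      rw [h1, h2, h3, real_inner_smul_right, hbB]
    rw [hM, hιsq, e1, e2]
    show _ ≤ ⟪𝒜 (J ψ) + 𝒞 (S ψ), J (W ψ)⟫_ℝ + ⟪ℬ (S ψ), W ψ⟫_ℝ
    rw [e3, e4]
    exact h1
  have hbdd : ∀ ψ, |ℓ ψ| ≤ (‖F - 𝒞 c‖ * ‖WH‖ + ‖B wT‖ + k * ‖W (ℬ c)‖) *
      (‖ι ψ‖ + ‖∫ s in 0..T, ψ s‖) := by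
    intro ψ
    have n1 : ‖J ψ‖ ≤ ‖ι ψ‖ := by
      refine le_of_sq_le_sq ?_ (norm_nonneg _)
      rw [hιsq]; linarith [sq_nonneg ‖S ψ‖]
    have n2 : ‖S ψ‖ ≤ ‖ι ψ‖ := by
      refine le_of_sq_le_sq ?_ (norm_nonneg _)
      rw [hιsq]; linarith [sq_nonneg ‖J ψ‖]
    have b1 : |⟪F - 𝒞 c, J (W ψ)⟫_ℝ| ≤ ‖F - 𝒞 c‖ * ‖WH‖ * ‖ι ψ‖ := by
      refine (abs_real_inner_le_norm _ _).trans ?_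
      rw [hJW, mul_assoc]
      gcongr
      exact (WH.le_opNorm _).trans (by gcongr)
    -- The norm of ι ψ does not control ψ in L²(0,T;V), so this term is integrated by parts; the
    -- boundary term is why φ(0) enters as the extra quantity q.
    have e1 : ⟪ℬ c, W ψ⟫_ℝ = B wT (∫ s in 0..T, ψ s) + k * ⟪W (ℬ c), S ψ⟫_ℝ := by
      have h1 : ⟪ℬ c, W ψ⟫_ℝ = ∫ t, Real.exp (k * t) * B wT (ψ t) ∂timeMeasure T := by
        rw [L2.inner_def]
        refine integral_congr_ae ?_
        filter_upwards [hℬt c, hct, hW ψ] with t h1 h2 h3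
        rw [h1, h2, h3, real_inner_smul_right, hbB]
      have h2 : k * ⟪W (ℬ c), S ψ⟫_ℝ =
          ∫ t, k * Real.exp (k * t) * B wT (∫ s in t..T, ψ s) ∂timeMeasure T := by
        rw [L2.inner_def, ← integral_const_mul]
        refine integral_congr_ae ?_
        filter_upwards [hℬt c, hct, hW (ℬ c), hS ψ] with t h1 h2 h3 h4
        rw [h3, h1, h2, h4, real_inner_smul_left, hbB, mul_assoc]
      rw [h1, h2, integral_timeMeasure_eq hT.le, integral_timeMeasure_eq hT.le]
      exact integral_exp_mul_dual_tail hT.le (hψi ψ) (B wT)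
    have b2 : |⟪ℬ c, W ψ⟫_ℝ| ≤ ‖B wT‖ * ‖∫ s in 0..T, ψ s‖ + k * ‖W (ℬ c)‖ * ‖ι ψ‖ := by
      rw [e1]
      refine (abs_add_le _ _).trans (add_le_add ((B wT).le_opNorm _) ?_)
      rw [abs_mul, abs_of_nonneg hk0, mul_assoc]
      gcongr
      exact (abs_real_inner_le_norm _ _).trans (by gcongr)
    rw [hℓ]
    refine (abs_sub _ _).trans ((add_le_add b1 b2).trans ?_)
    have p1 : 0 ≤ ‖F - 𝒞 c‖ * ‖WH‖ * ‖∫ s in 0..T, ψ s‖ := by positivity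
    have p2 : 0 ≤ ‖B wT‖ * ‖ι ψ‖ := by positivity
    have p3 : 0 ≤ k * ‖W (ℬ c)‖ * ‖∫ s in 0..T, ψ s‖ := by positivity
    linarith
  obtain ⟨x, hx, hxM⟩ := exists_mem_closure_range_forall_inner_eq ι M ℓ
    (fun ψ => ‖∫ s in 0..T, ψ s‖) (by positivity : 0 < α / 2) (by positivity) hcoer hbdd
  -- That u is the tail integral of p, read in `H`, is a closed condition, so it passes from the
  -- range of ι to its closure.
  have hxc : SH x.fst = J x.snd := by
    have hcl : IsClosed {x : X | SH x.fst = J x.snd} := by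
      have hf : Continuous fun x : X => x.fst :=
        continuous_fst.comp (WithLp.prod_continuous_ofLp 2 _ _)
      have hs : Continuous fun x : X => x.snd :=
        continuous_snd.comp (WithLp.prod_continuous_ofLp 2 _ _)
      exact isClosed_eq (SH.continuous.comp hf) (J.continuous.comp hs)
    refine closure_minimal ?_ hcl hx
    rintro _ ⟨ψ, rfl⟩
    exact hSJ ψ
  set w : Lp V 2 (timeMeasure T) := x.snd + c with hw
  set J' : Lp H 2 (timeMeasure T) →L[ℝ] Lp V 2 (timeMeasure T) :=
    j.adjoint.compLpL 2 (timeMeasure T) with hJ'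
  have hJ't : ∀ G, J' G =ᵐ[timeMeasure T] fun t => j.adjoint (G t) :=
    fun G => j.adjoint.coeFn_compLpL G
  have hJ'J : ∀ G ψ, ⟪J' G, ψ⟫_ℝ = ⟪G, J ψ⟫_ℝ := fun G ψ => by
    rw [L2.inner_def, L2.inner_def]
    refine integral_congr_ae ?_
    filter_upwards [hJ't G, hJt ψ] with t h1 h2
    rw [h1, h2, ContinuousLinearMap.adjoint_inner_left]
  -- Testing with e^{-kt}θ removes the weight; θ ranges over all of L²(0,T;V), so the equation holds
  -- almost everywhere.
  have hzero : J' (𝒜 x.fst + 𝒞 w - F) + ℬ w = 0 := by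
    refine ext_inner_right ℝ fun θ => ?_
    have h1 := hxM (W' θ)
    rw [hM, hℓ, hWW'] at h1
    rw [inner_zero_left, inner_add_left, hJ'J, hw, map_add, map_add]
    simp only [inner_add_left, inner_sub_left] at h1 ⊢
    linarith
  refine ⟨w, x.fst, ?_, ?_⟩
  · have h1 : ∀ᵐ t ∂timeMeasure T, (SH x.fst) t = (J x.snd) t := by
      rw [hxc]; exact .of_forall fun _ => rfl
    filter_upwards [h1, hSH x.fst, hJt x.snd, Lp.coeFn_add x.snd c, hct] with t h1 h2 h3 h4 h5
    rw [h4, Pi.add_apply, map_add, ← h3, ← h1, h2, h5, add_comm]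
  · have h0 := (Lp.ext_iff.1 hzero).trans (Lp.coeFn_zero _ _ _)
    filter_upwards [h0, Lp.coeFn_add (J' (𝒜 x.fst + 𝒞 w - F)) (ℬ w), hJ't (𝒜 x.fst + 𝒞 w - F),
      hℬt w, Lp.coeFn_sub (𝒜 x.fst + 𝒞 w) F, Lp.coeFn_add (𝒜 x.fst) (𝒞 w), h𝒜t x.fst, h𝒞 w]
      with t h0 h1 h2 h3 h4 h5 h6 h7
    ext v
    have h8 : ⟪j.adjoint (A (x.fst t) + C t (w t) - F t) + b (w t), v⟫_ℝ = 0 := by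
      rw [← h6, ← h7, ← Pi.add_apply, ← h5, ← Pi.sub_apply, ← h4, ← h2, ← h3, ← Pi.add_apply, ← h1,
        h0]
      simp
    rw [inner_add_left, hbB, ContinuousLinearMap.adjoint_inner_left] at h8
    rw [toDualV_apply]
    simp only [inner_sub_left, inner_add_left] at h8 ⊢
    linarith

end Existence

/-! ### Essential bounds and recovery from the final value -/

section FinalValue

variable {E : Type*} [NormedAddCommGroup E]

theorem MeasureTheory.MemLp.exists_ae_norm_le {X : Type*} [MeasurableSpace X] {μ : Measure X}
    {f : X → E} (hf : MemLp f ⊤ μ) : ∃ M, ∀ᵐ t ∂μ, ‖f t‖ ≤ M := by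
  have h := hf.2
  rw [eLpNorm_exponent_top] at h
  refine ⟨(eLpNormEssSup f μ).toReal, ?_⟩
  filter_upwards [ae_le_eLpNormEssSup (f := f) (μ := μ)] with t ht
  have := ENNReal.toReal_mono h.ne ht
  rwa [toReal_enorm] at this

/-- A function in `H¹(0,T)` is recovered from its final value and its weak derivative. -/
theorem HasH1Deriv.ae_eq_sub_integral_tail [NormedSpace ℝ E] [CompleteSpace E] {T : ℝ}
    (hT : 0 < T) {u g : ℝ → E} (h : HasH1Deriv T u g) {e : E} (he : HasFinalValue T u e) :
    ∀ᵐ t ∂timeMeasure T, u t = e - ∫ s in t..T, g s := by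
  have hgi := h.memLp_deriv.intervalIntegrable_of_timeMeasure hT.le
  obtain ⟨c, hc⟩ := h.exists_ae_eq_primitive hT
  have hU : ContinuousOn (fun t => c + ∫ s in 0..t, g s) (Icc 0 T) :=
    continuousOn_of_eq_primitive hgi hT.le (by simp)
  have hcT : c + ∫ s in 0..T, g s = e := he.eq_of_ae_eq hT hU hc
  filter_upwards [hc, ae_restrict_mem measurableSet_Ioo] with t ht htm
  have hm := Ioo_subset_Icc_self htm
  rw [ht, ← hcT, ← intervalIntegral.integral_add_adjacent_intervals
    (hgi.mono_of_mem_Icc ⟨le_rfl, hT.le⟩ hm) (hgi.mono_of_mem_Icc hm ⟨hT.le, le_rfl⟩)]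
  abel

end FinalValue

/-! ### Reduction to the coercive case and the main theorem -/

section BackwardProblem

variable {V H : Type*} [NormedAddCommGroup V] [InnerProductSpace ℝ V]
  [NormedAddCommGroup H] [InnerProductSpace ℝ H]

/-- Solutions do not change when a multiple of the inner product of `H` is added to `B` and
subtracted from `C`. -/
theorem form_shift_equation_iff (j : V →L[ℝ] H) {B B' : V →L[ℝ] StrongDual ℝ V} {lam : ℝ}
    (hB' : ∀ v w, B' v w = B v w + lam * ⟪j v, j w⟫_ℝ) (C : V →L[ℝ] H) (w : V) (h F : H) :
    - toDualV j h + B w + toDualV j (C w) = toDualV j F ↔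
      B' w = toDualV j (F + h - (C - lam • j) w) := by
  simp only [ContinuousLinearMap.ext_iff, _root_.add_apply, _root_.neg_apply, toDualV_apply, hB',
    _root_.sub_apply, _root_.smul_apply, inner_add_left, inner_sub_left, real_inner_smul_left]
  exact forall_congr' fun v => ⟨fun h => by linarith, fun h => by linarith⟩

/-- Solutions of the coercive problem in `L²(0,T;V)` are essentially bounded in `V`. -/
theorem form_solution_bounded [CompleteSpace V] [CompleteSpace H] {j : V →L[ℝ] H}
    (hj : DenseRange j) {B : V →L[ℝ] StrongDual ℝ V} {α : ℝ} (hα : 0 < α)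
    (hB : ∀ w, α * ‖w‖ ^ 2 ≤ B w w) (hBs : ∀ v w, B v w = B w v) {T : ℝ} (hT : 0 < T)
    {w : ℝ → V} {f g : ℝ → H} {wT : V} (hf : MemLp f 2 (timeMeasure T))
    (hg : MemLp g 2 (timeMeasure T))
    (hw : ∀ᵐ t ∂timeMeasure T, j (w t) = j wT - ∫ s in t..T, g s)
    (hBw : ∀ᵐ t ∂timeMeasure T, B (w t) = toDualV j (f t)) :
    ∃ M, ∀ᵐ t ∂timeMeasure T, ‖w t‖ ≤ M := by
  have hfg : Integrable (fun t => ‖f t‖ * ‖g t‖) (timeMeasure T) :=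
    hf.norm.integrable_mul hg.norm
  refine ⟨√((B wT wT + 2 * ∫ t in Ioo 0 T, ‖f t‖ * ‖g t‖) / α), ?_⟩
  filter_upwards [form_energy_le hj hα hB hBs hT hf hg hw hBw, ae_restrict_mem measurableSet_Ioo]
    with a ha ham
  refine Real.le_sqrt_of_sq_le ?_
  rw [le_div_iff₀ hα]
  have h1 : ‖∫ s in a..T, ⟪f s, g s⟫_ℝ‖ ≤ ∫ t in Ioo 0 T, ‖f t‖ * ‖g t‖ := by
    rw [intervalIntegral.integral_of_le ham.2.le]
    have hsub : Ioc a T ≤ᵐ[volume] Ioo 0 T :=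
      (Ioc_subset_Ioc_left ham.1.le).eventuallyLE.trans Ioo_ae_eq_Ioc.symm.le
    refine (norm_integral_le_of_norm_le (hfg.mono_measure (Measure.restrict_mono_ae hsub))
      (.of_forall fun t => norm_inner_le_norm _ _)).trans ?_
    exact setIntegral_mono_set hfg (.of_forall fun t => by positivity) hsub
  have h2 := (abs_le.1 h1).1
  linarith [hB (w a)]

end BackwardProblem

theorem lemma4p2 {V H : Type*}
    [NormedAddCommGroup V] [InnerProductSpace ℝ V] [CompleteSpace V]
    [TopologicalSpace.SeparableSpace V]
    [NormedAddCommGroup H] [InnerProductSpace ℝ H] [CompleteSpace H]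
    (j : V →L[ℝ] H) (hj : IsHilbertTriplet j)
    (T : ℝ) (hT : 0 < T)
    (A : H →L[ℝ] H) (B : V →L[ℝ] StrongDual ℝ V) (C : ℝ → V →L[ℝ] H)
    (α lam K : ℝ) (hα : 0 < α) (hlam : 0 < lam) (hK : 0 < K)
    (hA : ∀ w : H, α * ‖w‖ ^ 2 ≤ ⟪A w, w⟫_ℝ)
    (hB : ∀ w : V, α * ‖w‖ ^ 2 ≤ B w w + lam * ‖j w‖ ^ 2)
    (hC : ∀ᵐ t ∂(timeMeasure T), ∀ w : V, ‖C t w‖ ≤ K * ‖w‖)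
    (hCmeas : ∀ (w₁ : V) (w₂ : H), AEMeasurable (fun t => ⟪C t w₁, w₂⟫_ℝ) (timeMeasure T))
    (hBsymm : ∀ v w : V, B v w = B w v)
    (F : Lp H 2 (timeMeasure T)) (wT : V) :
    ∃! w : Lp V ⊤ (timeMeasure T), IsFinalValueSolution j T A B C F wT w := by
  -- Separability passes to `H` through the dense range of `j`; it is what turns weak measurability
  -- of C(t)v into strong measurability.
  have hsep : TopologicalSpace.SeparableSpace H := hj.denseRange.separableSpace j.continuous
  set B' : V →L[ℝ] StrongDual ℝ V := B + lam • (realInnerL H).bilinearComp j j with hB'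
  have hB'a : ∀ v w, B' v w = B v w + lam * ⟪j v, j w⟫_ℝ := fun v w => rfl
  have hB'c : ∀ w, α * ‖w‖ ^ 2 ≤ B' w w := fun w => by
    rw [hB'a, real_inner_self_eq_norm_sq]; exact hB w
  have hB's : ∀ v w, B' v w = B' w v := fun v w => by
    rw [hB'a, hB'a, hBsymm, real_inner_comm]
  set C' : ℝ → V →L[ℝ] H := fun t => C t - lam • j with hC'
  have hC'b : ∀ᵐ t ∂timeMeasure T, ∀ v, ‖C' t v‖ ≤ (K + lam * ‖j‖) * ‖v‖ := by
    filter_upwards [hC] with t ht v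
    refine (norm_sub_le _ _).trans ?_
    change ‖C t v‖ + ‖lam • j v‖ ≤ _
    rw [add_mul, norm_smul, Real.norm_of_nonneg hlam.le, mul_assoc]
    gcongr
    · exact ht v
    · exact j.le_opNorm v
  have hC'm : ∀ v, AEStronglyMeasurable (fun t => C' t v) (timeMeasure T) := fun v =>
    (aestronglyMeasurable_of_inner (hCmeas v)).sub aestronglyMeasurable_const
  have huniq : ∀ z₁ z₂ : Lp V ⊤ (timeMeasure T), IsFinalValueSolution j T A B C F wT z₁ →
      IsFinalValueSolution j T A B C F wT z₂ → z₁ = z₂ := by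
    rintro z₁ z₂ ⟨⟨g₁, hg₁, heq₁⟩, hT₁⟩ ⟨⟨g₂, hg₂, heq₂⟩, hT₂⟩
    have hz : MemLp (fun t => z₁ t - z₂ t) ⊤ (timeMeasure T) := (Lp.memLp z₁).sub (Lp.memLp z₂)
    obtain ⟨M, hM⟩ := hz.exists_ae_norm_le
    have hg := hg₁.sub hg₂
    have hzero := form_solution_eq_zero (w := fun t => z₁ t - z₂ t) (M := M) hj.denseRange hT hα hA
      hB'c hB's hC'b hC'm hz.1 hM hg.memLp_deriv
      (by simpa using hg.ae_eq_sub_integral_tail hT (hT₁.sub hT₂)) (by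
        filter_upwards [heq₁, heq₂] with t h₁ h₂
        rw [form_shift_equation_iff j hB'a] at h₁ h₂
        ext v
        have h₁' := congrArg (fun l : StrongDual ℝ V => l v) h₁
        have h₂' := congrArg (fun l : StrongDual ℝ V => l v) h₂
        simp only [toDualV_apply, map_sub, _root_.sub_apply, inner_sub_left, inner_add_left, hC']
          at h₁' h₂' ⊢
        linarith)
    refine Lp.ext (hzero.mono fun t ht => sub_eq_zero.1 ht)
  obtain ⟨w, p, hwp, hweq⟩ := exists_weak_solution hT hα hA hB'c hB's hC'b hC'm F wT
  have hp := Lp.memLp p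
  have hpi := hp.intervalIntegrable_of_timeMeasure hT.le
  -- The derivative of w is -p, whence the sign changes below.
  obtain ⟨M, hM⟩ := form_solution_bounded hj.denseRange hα hB'c hB's hT
    (((Lp.memLp F).sub (A.comp_memLp' hp)).sub ((Lp.memLp w).clm_family_apply hC'm hC'b))
    hp.neg (wT := wT) (by
      filter_upwards [hwp] with t ht
      rw [ht]
      simp only [Pi.neg_apply, intervalIntegral.integral_neg, sub_neg_eq_add]) hweq
  have hwtop : MemLp w ⊤ (timeMeasure T) := memLp_top_of_bound (Lp.memLp w).1 M hM
  set W : Lp V ⊤ (timeMeasure T) := hwtop.toLp w with hW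
  have hU : ∀ t ∈ Icc 0 T, j wT + ∫ s in t..T, p s =
      (j wT + ∫ s in 0..T, p s) + ∫ s in 0..t, (-p : ℝ → H) s := fun t ht => by
    rw [integral_tail_eq hpi ht, add_assoc]; rfl
  have hjw : (fun t => j (W t)) =ᵐ[timeMeasure T] fun t => j wT + ∫ s in t..T, p s := by
    filter_upwards [hwtop.coeFn_toLp, hwp] with t h1 h2
    rw [h1, h2]
  have hsol : IsFinalValueSolution j T A B C F wT W := by
    refine ⟨⟨-p, hasH1Deriv_of_ae_eq_primitive hT.le hp.neg hU hjw, ?_⟩,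
      fun t => j wT + ∫ s in t..T, p s, continuousOn_of_eq_primitive hpi.neg hT.le hU, hjw.symm,
      by simp⟩
    filter_upwards [hwtop.coeFn_toLp, hweq] with t h1 h2
    rw [h1, form_shift_equation_iff j hB'a, h2, Pi.neg_apply, map_neg, ← sub_eq_add_neg]
  exact ⟨W, hsol, fun z hz => huniq z W hz hsol⟩
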